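/- Let $\Gamma$ be a compact metric graph with $N$ edges of commensurate lengths $l_j=m_jl_0$, where $l_0>0$ and $m_j\in\mathbb{N}$, $m_j\ge 1$, each edge $j$ being identified with $[0,l_j]$. Let $U$ be a unitary $2N\times 2N$ matrix, and let the damping functions $a_j$ and the potentials $b_j$ be real-valued, bounded and continuous on each edge. A number $\lambda\in\mathbb{C}$ is called an eigenvalue of the problem $(a,b)$ if there is a non-zero $u=(u_1,\dots,u_N)$, $u_j\in W^{2,2}(0,l_j)$, with $$u_j''-(\lambda^2+2\lambda a_j-b_j)\,u_j=0\ \text{ on }(0,l_j),\quad j=1,\dots,N,\qquad (U-I)\Psi+i(U+I)\Psi'=0,$$ where $\Psi\in\mathbb{C}^{2N}$ is the vector of the end values $u_j(0),u_j(l_j)$ and $\Psi'$ the vector of the corresponding outgoing derivatives $u_j'(0),-u_j'(l_j)$. Write $\bar f_j=\frac1{l_j}\int_0^{l_j}f_j(x)\,dx$ for the average over the edge $j$, and let $(\bar a,\bar b)$ be the problem in which all $a_j$ and $b_j$ are replaced by the constants $\bar a_j$ and $\bar b_j$. Then the constant terms $c_0$ in the high-frequency expansion $$\lambda_n=\frac{2\pi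 i n}{l_0}+c_0+o(1),\qquad |n|\to\infty,$$ of the eigenvalues are the same for $(a,b)$ and for $(\bar a,\bar b)$. Precisely: (i) There are numbers $c^{(s)}\in\mathbb{C}$, $s=1,\dots,2\sum_j m_j$ (not necessarily distinct), such that for each of the two problems and for each $s$ there are eigenvalues $\lambda_n$ with $\lambda_n-2\pi i n/l_0\to c^{(s)}$ as $n\to+\infty$, and also such eigenvalues as $n\to-\infty$; moreover, for each of the two problems and every $\varepsilon>0$, every eigenvalue with sufficiently large $|\mathrm{Im}\,\lambda|$ lies within distance $\varepsilon$ of one of the points $2\pi i n/l_0+c^{(s)}$, $n\in\mathbb{Z}$. (ii) The set of all $c_0\in\mathbb{C}$ for which there are eigenvalues $\lambda_n$ with $\lambda_n-2\pi i n/l_0\to c_0$ as $n\to+\infty$ is the same for $(a,b)$ and $(\bar a,\bar b)$; the same holds for $n\to-\infty$. (iii) Call $c\in\mathbb{R}$ a high frequency abscissa if there is a sequence of eigenvalues $\lambda_n$ with $\mathrm{Im}\,\lambda_n\to+\infty$ or $\mathrm{Im}\,\lambda_n\to-\infty$, and $\mathrm{Re}\,\lambda_n\to c$. The problems $(a,b)$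 and $(\bar a,\bar b)$ have the same high frequency abscissas. The high frequency abscissas depend only on the averages of the damping: if $a_j',b_j'$ are also real, bounded and continuous on each edge and $\bar a'_j=\bar a_j$ for all $j$, then $(a',b')$ and $(a,b)$ have the same high frequency abscissas. -/

import Mathlib

open Filter Topology MeasureTheory

/-- `u` is (the continuously differentiable representative of) an element of the Sobolev space
`W^{2,2}(0, l)`, with first derivative `du` (its continuous representative) and second weak
derivative `ddu`: the derivative `du` is absolutely continuous with `du' = ddu ∈ L²(0, l)`. -/
def IsSobolevW22 (l : ℝ) (u du ddu : ℝ → ℂ) : Prop :=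
  MemLp ddu 2 (volume.restrict (Set.Ioo 0 l)) ∧
  (∀ x ∈ Set.Icc 0 l, du x = du 0 + ∫ t in (0 : ℝ)..x, ddu t) ∧
  (∀ x ∈ Set.Icc 0 l, u x = u 0 + ∫ t in (0 : ℝ)..x, du t)

/-- The vector `Ψ` of the values at the `2N` edge ends: `(j, 0)` is the end `x = 0` and
`(j, 1)` the end `x = l j` of the edge `j`. -/
def endValues {N : ℕ} (l : Fin N → ℝ) (u : Fin N → ℝ → ℂ) : Fin N × Fin 2 → ℂ :=
  fun p => if p.2 = 0 then u p.1 0 else u p.1 (l p.1)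

/-- The vector `Ψ'` of the outgoing derivatives (pointing from the vertex into the edge) at the
`2N` edge ends, where `du j` is the derivative on the edge `j`. -/
def endDerivs {N : ℕ} (l : Fin N → ℝ) (du : Fin N → ℝ → ℂ) : Fin N × Fin 2 → ℂ :=
  fun p => if p.2 = 0 then du p.1 0 else -du p.1 (l p.1)

/-- The coupling condition `(U - I) Ψ + i (U + I) Ψ' = 0`. A graph with several vertices is the
case where `U` is block diagonal with respect to the partition of the edge ends into vertices. -/
def CouplingCondition {N : ℕ} (U : Matrix (Fin N × Fin 2) (Fin N × Fin 2) ℂ)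
    (Ψ Ψ' : Fin N × Fin 2 → ℂ) : Prop :=
  (U - 1).mulVec Ψ + Complex.I • (U + 1).mulVec Ψ' = 0

/-- The set of eigenvalues of the damped wave equation on the metric graph with edge lengths `l`,
coupling matrix `U`, damping functions `a` and potentials `b`: those `z` for which
`u_j'' - (z² + 2 z a_j - b_j) u_j = 0` on every edge has a non-zero solution with components in
`W^{2,2}` that satisfies the coupling condition. -/
def graphEigenvalues {N : ℕ} (l : Fin N → ℝ) (U : Matrix (Fin N × Fin 2) (Fin N × Fin 2) ℂ)
    (a b : Fin N → ℝ → ℝ) : Set ℂ :=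
  {z | ∃ u du ddu : Fin N → ℝ → ℂ,
    (∀ j, IsSobolevW22 (l j) (u j) (du j) (ddu j)) ∧
    (∀ j, ∀ᵐ x ∂(volume.restrict (Set.Ioo 0 (l j))),
      ddu j x - (z ^ 2 + 2 * z * (a j x : ℂ) - (b j x : ℂ)) * u j x = 0) ∧
    CouplingCondition U (endValues l u) (endDerivs l du) ∧
    ∃ j, ∃ x ∈ Set.Icc 0 (l j), u j x ≠ 0}

/-- The average of `f` over an edge of length `l`. -/
noncomputable def edgeAverage (l : ℝ) (f : ℝ → ℝ) : ℝ := l⁻¹ * ∫ x in (0 : ℝ)..l, f x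

/-- Every function is replaced by the constant function equal to its average over the edge. -/
noncomputable def averaged {N : ℕ} (l : Fin N → ℝ) (f : Fin N → ℝ → ℝ) : Fin N → ℝ → ℝ :=
  fun j _ => edgeAverage (l j) (f j)

/-- The functions are bounded and continuous on each (open) edge. -/
def BoundedContinuousOnEdges {N : ℕ} (l : Fin N → ℝ) (f : Fin N → ℝ → ℝ) : Prop :=
  ∀ j, ContinuousOn (f j) (Set.Ioo 0 (l j)) ∧ ∃ C : ℝ, ∀ x ∈ Set.Ioo 0 (l j), |f j x| ≤ C

/-- The constant terms `c₀` of the sequences `z_n = 2πin/l₀ + c₀ + o(1)` of elements of `S`,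
as `n` tends along `F` (`atTop` for `n → ∞`, `atBot` for `n → -∞`). -/
def constantTerms (S : Set ℂ) (l₀ : ℝ) (F : Filter ℤ) : Set ℂ :=
  {c | ∃ z : ℤ → ℂ, (∀ᶠ n in F, z n ∈ S) ∧
    Tendsto (fun n : ℤ => z n - 2 * Real.pi * Complex.I * n / l₀) F (𝓝 c)}

/-- The elements of `S` of large imaginary part have the asymptotics
`z_{n,s} = 2πin/l₀ + c_s + o(1)` as `|n| → ∞`: each `c_s` belongs to such sequences in `S`,
for `n → ∞` and for `n → -∞`, and every element of `S` of large imaginary part is close to one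
of the points `2πin/l₀ + c_s`. -/
def HasHighFrequencyExpansion (S : Set ℂ) (l₀ : ℝ) {ι : Type} (c : ι → ℂ) : Prop :=
  (∀ s, c s ∈ constantTerms S l₀ atTop ∧ c s ∈ constantTerms S l₀ atBot) ∧
  ∀ ε > 0, ∃ R : ℝ, ∀ z ∈ S, R ≤ |z.im| →
    ∃ (s : ι) (n : ℤ), ‖z - (2 * Real.pi * Complex.I * n / l₀ + c s)‖ < ε

/-- The high frequency abscissas of a problem with set of eigenvalues `S`. -/
def highFrequencyAbscissas (S : Set ℂ) : Set ℝ :=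
  {c | ∃ z : ℕ → ℂ, (∀ n, z n ∈ S) ∧
    (Tendsto (fun n => (z n).im) atTop atTop ∨ Tendsto (fun n => (z n).im) atTop atBot) ∧
    Tendsto (fun n => (z n).re) atTop (𝓝 c)}

/-! On an edge the equation reads u'' = (z² + 2zα)u with α = a - b/(2z). Put θ(x) = zx + ∫₀ˣ α and
split u into the amplitudes P = e^{-θ}(u + u'/z)/2 and Q = e^{θ}(u - u'/z)/2. Then P' = αe^{-2θ}Q
and Q' = -αe^{2θ}P exactly. In a strip |Re z| ≤ R the exponentials stay bounded and oscillate ever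
faster as |Im z| → ∞, so a Riemann–Lebesgue argument makes P and Q asymptotically constant
(`eventually_edge_amplitudes`). Up to o(1), crossing the edge j thus multiplies a wave by e^{z l_j +
A_j} with A_j = ∫ a_j, without reflection: only the integral of a_j survives, and b_j drops out.

At the vertices the unitary coupling, written for amplitudes, tends to "outgoing = S incoming" with
S = 1 - 2Π, where Π projects onto ker(U + 1) (`exists_coupling_normalization`). Away from z = 0 the
eigenvalues are the zeros of a holomorphic determinant D, which in every strip differs by o(1) from
det(1 - S W), W carrying the factors e^{z l_j + A_j}. Since l_j = m_j l₀, this is a polynomial F in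
w = e^{l₀z} that depends only on U, the m_j and the A_j. It satisfies F(0) = 1 and has degree 2∑m_j
because S² = 1 (`secularPolynomial_natDegree`), so its roots are nonzero and can be written
e^{l₀c_s} (`exists_exp_factorization`).

The function F(e^{l₀z}) has period 2πi/l₀. The maximum principle for 1/D gives a zero of D near each
of its zeros far up or down; conversely, a zero of D far out in a fixed strip makes F(e^{l₀z})
small, hence lies near one of its zeros (`hasHighFrequencyExpansion_of_secular`). A flux identity
confines all non-real eigenvalues to one strip (`abs_re_le_of_mem_graphEigenvalues`), so nothing is
missed.

The c_s are fixed before a and b are chosen (`exists_common_expansion`), so all problems with the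
same edge integrals of the damping share them. The expansion in turn determines the sets of constant
terms (`constantTerms_eq`) and of abscissas (`highFrequencyAbscissas_eq_range`). -/

/-! ### What a high frequency expansion determines: constant terms and abscissas. -/

/-- The points `2πik/l₀ + c` with `k` an integer form a closed set. -/
lemma isClosed_range_lattice {l₀ : ℝ} (hl₀ : 0 < l₀) (c : ℂ) :
    IsClosed (Set.range fun k : ℤ => 2 * Real.pi * Complex.I * k / l₀ + c) := by
  have h1 : IsClosedEmbedding (fun x : ℝ => x • (2 * Real.pi * Complex.I / l₀ : ℂ)) := by
    have := LinearMap.isClosedEmbedding_of_injective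
      (f := LinearMap.toSpanSingleton ℝ ℂ (2 * Real.pi * Complex.I / l₀ : ℂ)) (by
        rw [LinearMap.ker_eq_bot']
        intro x hx
        simpa [LinearMap.toSpanSingleton_apply, Real.pi_ne_zero, hl₀.ne'] using hx)
    exact this
  have h2 := (Homeomorph.addRight c).isClosedEmbedding.comp
    (h1.comp Int.isClosedEmbedding_coe_real)
  convert h2.isClosed_range using 2
  ext k
  simp
  ring

lemma im_lattice (l₀ : ℝ) (n : ℤ) : (2 * Real.pi * Complex.I * n / l₀ : ℂ).im =
    2 * Real.pi / l₀ * n := by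
  have : (2 * Real.pi * Complex.I * n / l₀ : ℂ) = ((2 * Real.pi / l₀ * n : ℝ) : ℂ) * Complex.I := by
    push_cast; ring
  rw [this, Complex.im_ofReal_mul]; simp

lemma re_lattice (l₀ : ℝ) (n : ℤ) : (2 * Real.pi * Complex.I * n / l₀ : ℂ).re = 0 := by
  have : (2 * Real.pi * Complex.I * n / l₀ : ℂ) = ((2 * Real.pi / l₀ * n : ℝ) : ℂ) * Complex.I := by
    push_cast; ring
  rw [this, Complex.re_ofReal_mul]; simp

/-- An expansion fixes the constants only modulo 2πi/l₀. A constant term of S is therefore some c_s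
shifted by a lattice vector, and re-indexing a sequence in T that belongs to c_s absorbs the shift.
-/
lemma constantTerms_subset {S T : Set ℂ} {l₀ : ℝ} (hl₀ : 0 < l₀) {ι : Type} [Finite ι]
    {c : ι → ℂ} (hS : HasHighFrequencyExpansion S l₀ c) (F : Filter ℤ) [F.NeBot]
    (hF : Tendsto (fun n : ℤ => |(n : ℝ)|) F atTop)
    (hshift : ∀ k : ℤ, Tendsto (fun n => n + k) F F)
    (hT : ∀ s, c s ∈ constantTerms T l₀ F) :
    constantTerms S l₀ F ⊆ constantTerms T l₀ F := by
  rintro c₀ ⟨z, hzS, hz⟩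
  have him : Tendsto (fun n => |(z n).im|) F atTop := by
    have h1 : Tendsto (fun n => (z n).im - 2 * Real.pi / l₀ * n) F (𝓝 c₀.im) := by
      have := (Complex.continuous_im.tendsto c₀).comp hz
      refine this.congr fun n => ?_
      simp only [Function.comp, Complex.sub_im, im_lattice]
    have h2 := h1.abs
    have h3 : Tendsto (fun n : ℤ => 2 * Real.pi / l₀ * |(n : ℝ)|) F atTop :=
      hF.const_mul_atTop (by positivity)
    have h4 : Tendsto (fun n : ℤ => 2 * Real.pi / l₀ * |(n : ℝ)| -
        |(z n).im - 2 * Real.pi / l₀ * n|) F atTop := by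
      simpa [sub_eq_add_neg] using h3.atTop_add h2.neg
    refine tendsto_atTop_mono (fun n => ?_) h4
    have h5 : |2 * Real.pi / l₀ * (n : ℝ)| = 2 * Real.pi / l₀ * |(n : ℝ)| := by
      rw [abs_mul, abs_of_pos (by positivity)]
    rw [← h5, abs_sub_comm]
    linarith [abs_sub_abs_le_abs_sub (2 * Real.pi / l₀ * (n : ℝ)) (z n).im]
  -- The expansion only says that c₀ is arbitrarily close to the shifted lattices; equality follows
  -- because a finite union of closed lattices is closed.
  have hmem : c₀ ∈ ⋃ s, Set.range fun k : ℤ => 2 * Real.pi * Complex.I * k / l₀ + c s := by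
    have hcl : IsClosed (⋃ s, Set.range fun k : ℤ => 2 * Real.pi * Complex.I * k / l₀ + c s) :=
      isClosed_iUnion_of_finite fun s => isClosed_range_lattice hl₀ _
    rw [← hcl.closure_eq, Metric.mem_closure_iff]
    intro ε hε
    obtain ⟨R, hR⟩ := hS.2 (ε / 2) (half_pos hε)
    obtain ⟨n, h1, h2, h3⟩ := (hzS.and ((him.eventually_ge_atTop R).and
      (Metric.tendsto_nhds.1 hz (ε / 2) (half_pos hε)))).exists
    obtain ⟨s, k, hk⟩ := hR _ h1 h2
    refine ⟨2 * Real.pi * Complex.I * (k - n : ℤ) / l₀ + c s,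
      Set.mem_iUnion.2 ⟨s, k - n, rfl⟩, ?_⟩
    rw [dist_comm, dist_eq_norm] at h3
    rw [dist_eq_norm]
    calc ‖c₀ - (2 * Real.pi * Complex.I * (k - n : ℤ) / l₀ + c s)‖
        = ‖(c₀ - (z n - 2 * Real.pi * Complex.I * n / l₀)) +
          (z n - (2 * Real.pi * Complex.I * k / l₀ + c s))‖ := by
          congr 1; push_cast; ring
      _ ≤ _ := norm_add_le _ _
      _ < ε := by linarith
  obtain ⟨s, k, hk⟩ := Set.mem_iUnion.1 hmem
  obtain ⟨w, hwT, hw⟩ := hT s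
  refine ⟨fun n => w (n + k), (hshift k).eventually hwT, ?_⟩
  have := (hw.comp (hshift k)).const_add (2 * Real.pi * Complex.I * k / l₀)
  rw [← hk]
  refine this.congr fun n => ?_
  simp only [Function.comp]
  push_cast
  ring

/-- The lattice shifts are purely imaginary, so real parts of far eigenvalues accumulate only at the
finitely many Re c_s. Each of these is attained already along n → +∞. -/
lemma highFrequencyAbscissas_eq_range {S : Set ℂ} {l₀ : ℝ} (hl₀ : 0 < l₀) {ι : Type} [Finite ι]
    {c : ι → ℂ} (hS : HasHighFrequencyExpansion S l₀ c) :
    highFrequencyAbscissas S = Set.range fun s => (c s).re := by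
  apply Set.Subset.antisymm
  · rintro r ⟨z, hzS, him, hre⟩
    have habs : Tendsto (fun n => |(z n).im|) atTop atTop := by
      rcases him with h | h
      · exact tendsto_abs_atTop_atTop.comp h
      · exact tendsto_abs_atBot_atTop.comp h
    rw [← (Set.finite_range fun s => (c s).re).isClosed.closure_eq, Metric.mem_closure_iff]
    intro ε hε
    obtain ⟨R, hR⟩ := hS.2 (ε / 2) (half_pos hε)
    obtain ⟨n, h2, h3⟩ := ((habs.eventually_ge_atTop R).and
      (Metric.tendsto_nhds.1 hre (ε / 2) (half_pos hε))).exists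
    obtain ⟨s, k, hk⟩ := hR _ (hzS n) h2
    refine ⟨(c s).re, ⟨s, rfl⟩, ?_⟩
    have h4 := (Complex.abs_re_le_norm _).trans_lt hk
    rw [Complex.sub_re, Complex.add_re, re_lattice, zero_add] at h4
    rw [Real.dist_eq] at h3 ⊢
    rw [abs_lt] at *
    constructor <;> linarith
  · rintro _ ⟨s, rfl⟩
    obtain ⟨z, hz, hlim⟩ := (hS.1 s).1
    obtain ⟨n₀, hn₀⟩ := eventually_atTop.1 hz
    have hsub : Tendsto (fun n : ℕ => (n : ℤ) + n₀) atTop atTop :=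
      tendsto_atTop_add_const_right _ _ tendsto_natCast_atTop_atTop
    refine ⟨fun n => z (n + n₀), fun n => hn₀ _ (by omega), Or.inl ?_, ?_⟩
    · have h1 : Tendsto (fun n : ℤ => (z n).im - 2 * Real.pi / l₀ * n) atTop (𝓝 (c s).im) := by
        refine ((Complex.continuous_im.tendsto _).comp hlim).congr fun n => ?_
        simp only [Function.comp, Complex.sub_im, im_lattice]
      have h2 : Tendsto (fun n : ℤ => 2 * Real.pi / l₀ * (n : ℝ)) atTop atTop :=
        tendsto_intCast_atTop_atTop.const_mul_atTop (by positivity)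
      have h3 : Tendsto (fun n : ℤ => (z n).im) atTop atTop :=
        (h2.atTop_add h1).congr fun n => by ring
      exact h3.comp hsub
    · have h1 : Tendsto (fun n : ℤ => (z n).re) atTop (𝓝 (c s).re) := by
        refine ((Complex.continuous_re.tendsto _).comp hlim).congr fun n => ?_
        simp only [Function.comp, Complex.sub_re, re_lattice, sub_zero]
      exact h1.comp hsub

lemma tendsto_abs_intCast_atTop : Tendsto (fun n : ℤ => |(n : ℝ)|) atTop atTop :=
  tendsto_abs_atTop_atTop.comp tendsto_intCast_atTop_atTop

lemma tendsto_abs_intCast_atBot : Tendsto (fun n : ℤ => |(n : ℝ)|) atBot atTop :=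
  tendsto_abs_atBot_atTop.comp (tendsto_intCast_atBot_iff.2 tendsto_id)

/-- Sets with the same high frequency expansion have the same constant terms. -/
lemma constantTerms_eq {S T : Set ℂ} {l₀ : ℝ} (hl₀ : 0 < l₀) {ι : Type} [Finite ι]
    {c : ι → ℂ} (hS : HasHighFrequencyExpansion S l₀ c) (hT : HasHighFrequencyExpansion T l₀ c) :
    constantTerms S l₀ atTop = constantTerms T l₀ atTop ∧
      constantTerms S l₀ atBot = constantTerms T l₀ atBot := by
  have hp : ∀ k : ℤ, Tendsto (fun n => n + k) atTop atTop := fun k =>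
    tendsto_atTop_add_const_right _ _ tendsto_id
  have hm : ∀ k : ℤ, Tendsto (fun n => n + k) atBot atBot := fun k =>
    tendsto_atBot_add_const_right _ _ tendsto_id
  exact ⟨Set.Subset.antisymm
      (constantTerms_subset hl₀ hS _ tendsto_abs_intCast_atTop hp fun s => (hT.1 s).1)
      (constantTerms_subset hl₀ hT _ tendsto_abs_intCast_atTop hp fun s => (hS.1 s).1),
    Set.Subset.antisymm
      (constantTerms_subset hl₀ hS _ tendsto_abs_intCast_atBot hm fun s => (hT.1 s).2)
      (constantTerms_subset hl₀ hT _ tendsto_abs_intCast_atBot hm fun s => (hS.1 s).2)⟩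

/-! ### Zeros of functions asymptotic to an exponential polynomial in vertical strips. -/

/-- The filter of complex numbers `z` with `|Re z| ≤ R` and `|Im z| → ∞`. -/
def highFrequencyFilter (R : ℝ) : Filter ℂ :=
  comap (fun z : ℂ => |z.im|) atTop ⊓ 𝓟 {z | |z.re| ≤ R}

lemma eventually_highFrequencyFilter {R : ℝ} {p : ℂ → Prop} :
    (∀ᶠ z in highFrequencyFilter R, p z) ↔
      ∃ T : ℝ, ∀ z : ℂ, |z.re| ≤ R → T ≤ |z.im| → p z := by
  rw [highFrequencyFilter, eventually_inf_principal, eventually_comap, eventually_atTop]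
  constructor
  · rintro ⟨T, hT⟩
    exact ⟨T, fun z h1 h2 => hT _ h2 z rfl h1⟩
  · rintro ⟨T, hT⟩
    exact ⟨T, fun y hy z hz h1 => hT z h1 (by rw [hz]; exact hy)⟩

lemma tendsto_norm_highFrequencyFilter (R : ℝ) :
    Tendsto (fun z : ℂ => ‖z‖) (highFrequencyFilter R) atTop := by
  rw [tendsto_atTop]
  intro b
  exact eventually_highFrequencyFilter.2 ⟨b, fun z _ h => h.trans (Complex.abs_im_le_norm z)⟩

/-- A small value of `∏ (e^{l₀z} - e^{l₀c_s})` forces `z` to be close to a zero. -/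
lemma exists_near_of_norm_prod_lt {l₀ : ℝ} (hl₀ : 0 < l₀) {ι : Type} [Fintype ι] (c : ι → ℂ)
    {ε : ℝ} (hε : 0 < ε) :
    ∃ δ > 0, ∀ z : ℂ, ‖∏ s, (Complex.exp (l₀ * z) - Complex.exp (l₀ * c s))‖ < δ →
      ∃ (s : ι) (n : ℤ), ‖z - (2 * Real.pi * Complex.I * n / l₀ + c s)‖ < ε := by
  have hlog : Tendsto Complex.log (𝓝 1) (𝓝 0) := by
    have := (continuousAt_clog (x := 1) (by simp)).tendsto
    rwa [Complex.log_one] at this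
  obtain ⟨η, hη, h⟩ := Metric.eventually_nhds_iff.1
    ((Metric.tendsto_nhds.1 hlog (ε * l₀) (by positivity)).and
      (isOpen_ne.mem_nhds (one_ne_zero : (1 : ℂ) ≠ 0)))
  -- With a threshold of product form, a product below it must have one factor below its own share;
  -- dividing by e^{l₀c_s} then puts e^{l₀(z - c_s)} in the η-ball about 1, where the logarithm is
  -- smaller than εl₀.
  refine ⟨∏ s, η * ‖Complex.exp (l₀ * c s)‖,
    Finset.prod_pos fun s _ => mul_pos hη (norm_pos_iff.2 (Complex.exp_ne_zero _)), fun z hz => ?_⟩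
  rw [norm_prod] at hz
  obtain ⟨s, hs⟩ : ∃ s, ‖Complex.exp (l₀ * z) - Complex.exp (l₀ * c s)‖ <
      η * ‖Complex.exp (l₀ * c s)‖ := by
    by_contra! hcon
    exact absurd hz (not_lt.2 (Finset.prod_le_prod (fun s _ => by positivity) fun s _ => hcon s))
  set v := Complex.exp (l₀ * (z - c s)) with hv
  have hvd : dist v 1 < η := by
    have h0 : 0 < ‖Complex.exp (l₀ * c s)‖ := norm_pos_iff.2 (Complex.exp_ne_zero _)
    have : (v - 1) * Complex.exp (l₀ * c s) =
        Complex.exp (l₀ * z) - Complex.exp (l₀ * c s) := by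
      rw [sub_mul, hv, ← Complex.exp_add]; ring_nf
    rw [← this, norm_mul] at hs
    rw [dist_eq_norm]
    exact lt_of_mul_lt_mul_right hs h0.le
  obtain ⟨h1, h2⟩ := h hvd
  have h3 : Complex.exp (l₀ * (z - c s)) = Complex.exp (Complex.log v) := by
    rw [Complex.exp_log h2]
  obtain ⟨n, hn⟩ := Complex.exp_eq_exp_iff_exists_int.1 h3
  refine ⟨s, n, ?_⟩
  have hl : (l₀ : ℂ) ≠ 0 := by exact_mod_cast hl₀.ne'
  have h4 : z - (2 * Real.pi * Complex.I * n / l₀ + c s) = Complex.log v / l₀ := by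
    field_simp
    linear_combination hn
  rw [h4, norm_div, Complex.norm_real, Real.norm_of_nonneg hl₀.le, div_lt_iff₀ hl₀]
  simpa [dist_eq_norm] using h1

/-- A holomorphic function that is small at the centre of a disc and large on its boundary
has a zero. -/
lemma exists_zero_of_norm_lt {D : ℂ → ℂ} {p : ℂ} {r δ : ℝ} (hr : 0 < r)
    (hD : ∀ z ∈ Metric.closedBall p r, DifferentiableAt ℂ D z)
    (hp : ‖D p‖ < δ) (hs : ∀ z ∈ Metric.sphere p r, δ ≤ ‖D z‖) :
    ∃ z ∈ Metric.closedBall p r, D z = 0 := by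
  by_contra! hne
  have hδ : 0 < δ := (norm_nonneg _).trans_lt hp
  -- Without zeros, 1/D is holomorphic on the disc, and its maximum principle contradicts D being
  -- smaller at the centre than on the circle.
  have hd : DifferentiableOn ℂ (fun z => (D z)⁻¹) (Metric.closedBall p r) := fun z hz =>
    ((hD z hz).inv (hne z hz)).differentiableWithinAt
  have h1 := Complex.norm_le_of_forall_mem_frontier_norm_le (C := δ⁻¹) Metric.isBounded_ball
    (hd.diffContOnCl_ball subset_rfl) (fun z hz => by
      rw [frontier_ball _ hr.ne'] at hz
      rw [norm_inv]
      exact inv_anti₀ hδ (hs z hz)) (subset_closure (Metric.mem_ball_self hr))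
  rw [norm_inv] at h1
  have h2 : 0 < ‖D p‖ := norm_pos_iff.2 (hne p (Metric.mem_closedBall_self hr.le))
  exact absurd hp (not_lt.2 ((inv_le_inv₀ h2 hδ).1 h1))

/-- The approximating point of S in the hypothesis may change with ε. Choosing for each n a point
within 1/(1 + |n|) of the minimal distance gives a single sequence that works for every ε. -/
lemma exists_seq_of_infDist {S : Set ℂ} {l₀ : ℝ} {F : Filter ℤ} {c : ℂ} [F.NeBot]
    (hF : Tendsto (fun n : ℤ => |(n : ℝ)|) F atTop)
    (h : ∀ ε > 0, ∀ᶠ n : ℤ in F, ∃ z ∈ S, ‖z - (2 * Real.pi * Complex.I * n / l₀ + c)‖ < ε) :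
    c ∈ constantTerms S l₀ F := by
  obtain ⟨-, z₀, hz₀, -⟩ := (h 1 one_pos).exists
  have hpos : ∀ n : ℤ, 0 < (1 + |(n : ℝ)|)⁻¹ := fun n => by positivity
  have hex : ∀ n : ℤ, ∃ z ∈ S, dist (2 * Real.pi * Complex.I * n / l₀ + c) z <
      Metric.infDist (2 * Real.pi * Complex.I * n / l₀ + c) S + (1 + |(n : ℝ)|)⁻¹ := fun n =>
    (Metric.infDist_lt_iff ⟨z₀, hz₀⟩).1 (lt_add_of_pos_right _ (hpos n))
  choose z hzS hz using hex
  refine ⟨z, Eventually.of_forall hzS, ?_⟩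
  have h1 : Tendsto (fun n : ℤ => Metric.infDist (2 * Real.pi * Complex.I * n / l₀ + c) S)
      F (𝓝 0) := by
    rw [Metric.tendsto_nhds]
    intro ε hε
    filter_upwards [h ε hε] with n ⟨w, hw, hd⟩
    rw [Real.dist_0_eq_abs, abs_of_nonneg Metric.infDist_nonneg]
    refine (Metric.infDist_le_dist_of_mem hw).trans_lt ?_
    rwa [dist_comm, dist_eq_norm]
  have h2 : Tendsto (fun n : ℤ => (1 + |(n : ℝ)|)⁻¹) F (𝓝 0) :=
    (tendsto_atTop_add_const_left _ _ hF).inv_tendsto_atTop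
  have h3 := h1.add h2
  rw [add_zero] at h3
  rw [tendsto_iff_dist_tendsto_zero]
  refine squeeze_zero (fun _ => dist_nonneg) (fun n => ?_) h3
  refine le_trans (le_of_eq ?_) (hz n).le
  rw [dist_comm, dist_eq_norm, dist_eq_norm]
  congr 1
  ring

lemma eventually_ne_exp_prod {l₀ : ℝ} (hl₀ : 0 < l₀) {ι : Type} [Fintype ι] (c : ι → ℂ) (p : ℂ) :
    ∀ᶠ z in 𝓝[≠] p, ∏ s, (Complex.exp (l₀ * z) - Complex.exp (l₀ * c s)) ≠ 0 := by
  have hl : (l₀ : ℂ) ≠ 0 := by exact_mod_cast hl₀.ne'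
  have : ∀ s, ∀ᶠ z in 𝓝[≠] p, Complex.exp (l₀ * z) ≠ Complex.exp (l₀ * c s) := fun s => by
    have hd : HasDerivAt (fun z : ℂ => Complex.exp (l₀ * z)) (Complex.exp (l₀ * p) * l₀) p := by
      simpa using ((hasDerivAt_id p).const_mul (l₀ : ℂ)).cexp
    exact hd.eventually_ne (mul_ne_zero (Complex.exp_ne_zero _) hl)
  filter_upwards [eventually_all.2 this] with z hz
  exact Finset.prod_ne_zero_iff.2 fun s _ => sub_ne_zero.2 (hz s)

lemma exp_lattice_add {l₀ : ℝ} (hl₀ : 0 < l₀) (n : ℤ) (z : ℂ) :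
    Complex.exp (l₀ * (2 * Real.pi * Complex.I * n / l₀ + z)) = Complex.exp (l₀ * z) := by
  have hl : (l₀ : ℂ) ≠ 0 := by exact_mod_cast hl₀.ne'
  rw [Complex.exp_eq_exp_iff_exists_int]
  exact ⟨n, by field_simp; ring⟩

/-- If the elements of large imaginary part of `S` lie in a vertical strip and are the zeros of a
function `D`, holomorphic away from the origin and asymptotic to the exponential polynomial
`A ∏ (e^{l₀z} - e^{l₀c_s})` in every strip, then `S` has the constant terms `c_s`. -/
theorem hasHighFrequencyExpansion_of_secular {l₀ : ℝ} (hl₀ : 0 < l₀) {ι : Type} [Fintype ι]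
    (c : ι → ℂ) {A : ℂ} (hA : A ≠ 0) {S : Set ℂ} {D : ℂ → ℂ}
    (hD : ∀ z ≠ 0, DifferentiableAt ℂ D z)
    (hS : ∃ R₀ : ℝ, ∀ z : ℂ, R₀ ≤ |z.im| → (z ∈ S ↔ D z = 0))
    (hre : ∃ R₁ : ℝ, ∀ z ∈ S, z.im ≠ 0 → |z.re| ≤ R₁)
    (hlim : ∀ R, Tendsto (fun z => D z -
      A * ∏ s, (Complex.exp (l₀ * z) - Complex.exp (l₀ * c s))) (highFrequencyFilter R) (𝓝 0)) :
    HasHighFrequencyExpansion S l₀ c := by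
  obtain ⟨R₀, hS⟩ := hS
  obtain ⟨R₁, hre⟩ := hre
  set f : ℂ → ℂ := fun z => A * ∏ s, (Complex.exp (l₀ * z) - Complex.exp (l₀ * c s)) with hf
  have hfc : Continuous f := by fun_prop
  have hfper : ∀ (n : ℤ) z, f (2 * Real.pi * Complex.I * n / l₀ + z) = f z := fun n z => by
    simp only [hf, exp_lattice_add hl₀]
  have hclose : ∀ R, ∀ δ > 0, ∃ T : ℝ, ∀ z : ℂ, |z.re| ≤ R → T ≤ |z.im| →
      ‖D z - f z‖ < δ := fun R δ hδ =>
    eventually_highFrequencyFilter.1 (by simpa using Metric.tendsto_nhds.1 (hlim R) δ hδ)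
  have key : ∀ (s : ι) (F : Filter ℤ) [F.NeBot], Tendsto (fun n : ℤ => |(n : ℝ)|) F atTop →
      c s ∈ constantTerms S l₀ F := by
    intro s F _ hF
    refine exists_seq_of_infDist hF fun ε hε => ?_
    have h0 : ∀ᶠ z in 𝓝[≠] (c s), f z ≠ 0 := by
      filter_upwards [eventually_ne_exp_prod hl₀ c (c s)] with z hz using mul_ne_zero hA hz
    rw [eventually_nhdsWithin_iff, Metric.eventually_nhds_iff] at h0
    obtain ⟨ρ, hρ, h0⟩ := h0
    set r := min (ρ / 2) (ε / 2) with hr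
    have hr0 : 0 < r := by positivity
    have hrρ : r < ρ := (min_le_left _ _).trans_lt (half_lt_self hρ)
    have hrε : r < ε := (min_le_right _ _).trans_lt (half_lt_self hε)
    -- Half of the minimum of |f| on a circle that avoids the zeros of f. An error below δ then
    -- leaves |D| ≥ δ on the circle but |D| < δ at the centre, as `exists_zero_of_norm_lt` needs.
    obtain ⟨δ, hδ, hsph⟩ : ∃ δ > 0, ∀ z ∈ Metric.sphere (c s) r, 2 * δ ≤ ‖f z‖ := by
      obtain ⟨w, hw, hmin⟩ := (isCompact_sphere (c s) r).exists_isMinOn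
        (NormedSpace.sphere_nonempty.2 hr0.le) hfc.norm.continuousOn
      refine ⟨‖f w‖ / 2, half_pos (norm_pos_iff.2 (h0 ?_ ?_)), fun z hz => ?_⟩
      · rw [Metric.mem_sphere.1 hw]; exact hrρ
      · rintro rfl
        simp at hw
        exact hr0.ne hw
      · rw [mul_div_cancel₀ _ (two_ne_zero)]
        exact hmin hz
    -- All translates of the disc about c_s by lattice vectors lie in this one strip, and f is
    -- invariant under them, so the same δ serves for every n.
    obtain ⟨T, hT⟩ := hclose (|(c s).re| + r) δ hδ
    have hlarge : Tendsto (fun n : ℤ => 2 * Real.pi / l₀ * |(n : ℝ)|) F atTop :=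
      hF.const_mul_atTop (by positivity)
    -- The summands |Im c_s| and r carry the bound on |Im z| over to the whole disc about p; the 1
    -- in the maximum keeps the disc away from the origin, where D need not be holomorphic.
    filter_upwards [hlarge.eventually_ge_atTop (max (max T R₀) 1 + |(c s).im| + r)] with n hn
    set p : ℂ := 2 * Real.pi * Complex.I * n / l₀ + c s with hp
    have hball : ∀ z ∈ Metric.closedBall p r, |z.re| ≤ |(c s).re| + r ∧
        max (max T R₀) 1 ≤ |z.im| := by
      intro z hz
      rw [Metric.mem_closedBall, dist_eq_norm] at hz
      have h1 := (Complex.abs_re_le_norm _).trans hz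
      have h2 := (Complex.abs_im_le_norm _).trans hz
      rw [Complex.sub_re, hp, Complex.add_re, re_lattice, zero_add] at h1
      rw [Complex.sub_im, hp, Complex.add_im, im_lattice] at h2
      constructor
      · linarith [abs_sub_abs_le_abs_sub z.re (c s).re]
      · have h5 : |2 * Real.pi / l₀ * (n : ℝ)| = 2 * Real.pi / l₀ * |(n : ℝ)| := by
          rw [abs_mul, abs_of_pos (by positivity)]
        have h6 : |2 * Real.pi / l₀ * (n : ℝ)| ≤
            |z.im| + |z.im - (2 * Real.pi / l₀ * n + (c s).im)| + |(c s).im| := by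
          have e : 2 * Real.pi / l₀ * (n : ℝ) =
            z.im - (z.im - (2 * Real.pi / l₀ * n + (c s).im)) - (c s).im := by ring
          calc _ = |z.im - (z.im - (2 * Real.pi / l₀ * n + (c s).im)) - (c s).im| := by rw [← e]
            _ ≤ |z.im - (z.im - (2 * Real.pi / l₀ * n + (c s).im))| + |(c s).im| := abs_sub _ _
            _ ≤ _ := by gcongr; exact abs_sub _ _
        linarith
    have hDf : ∀ z ∈ Metric.closedBall p r, ‖D z - f z‖ < δ := fun z hz =>
      hT z (hball z hz).1 (((le_max_left _ _).trans (le_max_left _ _)).trans (hball z hz).2)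
    have hpz : f p = 0 := by
      rw [hp, hfper]
      simp only [hf]
      rw [Finset.prod_eq_zero (Finset.mem_univ s) (sub_self _), mul_zero]
    obtain ⟨z, hz, hz0⟩ := exists_zero_of_norm_lt (D := D) (p := p) (δ := δ) hr0
      (fun z hz => hD z (by
        rintro rfl
        have := (le_max_right _ _).trans (hball 0 hz).2
        norm_num at this))
      (by simpa [hpz] using hDf p (Metric.mem_closedBall_self hr0.le))
      (fun z hz => by
        have h1 := hDf z (Metric.sphere_subset_closedBall hz)
        have h2 : 2 * δ ≤ ‖f z‖ := by
          have := hsph (z - 2 * Real.pi * Complex.I * n / l₀) (by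
            rw [Metric.mem_sphere, dist_eq_norm] at hz ⊢
            rw [← hz, hp]; congr 1; ring)
          rwa [← hfper n, add_sub_cancel] at this
        have h3 := norm_sub_norm_le (f z) (D z)
        rw [norm_sub_rev] at h3
        linarith)
    refine ⟨z, (hS z (((le_max_right _ _).trans (le_max_left _ _)).trans (hball z hz).2)).2 hz0, ?_⟩
    rw [Metric.mem_closedBall, dist_eq_norm] at hz
    exact hz.trans_lt hrε
  refine ⟨fun s => ⟨key s _ tendsto_abs_intCast_atTop, key s _ tendsto_abs_intCast_atBot⟩, ?_⟩
  intro ε hε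
  obtain ⟨δ, hδ, h⟩ := exists_near_of_norm_prod_lt hl₀ c hε
  obtain ⟨T, hT⟩ := hclose R₁ (‖A‖ * δ) (mul_pos (norm_pos_iff.2 hA) hδ)
  refine ⟨max (max T R₀) 1, fun z hz him => h z ?_⟩
  have hz0 : z.im ≠ 0 := by
    intro h0
    have := (le_max_right _ _).trans him
    rw [h0] at this
    norm_num at this
  have h1 := hT z (hre z hz hz0) (((le_max_left _ _).trans (le_max_left _ _)).trans him)
  rw [(hS z (((le_max_right _ _).trans (le_max_left _ _)).trans him)).1 hz, zero_sub, norm_neg]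
    at h1
  simp only [hf, norm_mul] at h1
  exact lt_of_mul_lt_mul_left h1 (norm_nonneg A)

/-! ### Polynomial determinants and their roots as exponentials. -/

open Polynomial in
lemma natDegree_prod_le_and_coeff {R ι : Type*} [CommRing R] (s : Finset ι) (p : ι → R[X])
    (d : ι → ℕ) (h : ∀ i ∈ s, (p i).natDegree ≤ d i) :
    (∏ i ∈ s, p i).natDegree ≤ ∑ i ∈ s, d i ∧
      (∏ i ∈ s, p i).coeff (∑ i ∈ s, d i) = ∏ i ∈ s, (p i).coeff (d i) := by
  classical
  induction s using Finset.induction_on with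
  | empty => simp
  | insert i s hi ih =>
    obtain ⟨h1, h2⟩ := ih fun j hj => h j (Finset.mem_insert_of_mem hj)
    have h3 := h i (Finset.mem_insert_self i s)
    rw [Finset.prod_insert hi, Finset.sum_insert hi, Finset.prod_insert hi]
    exact ⟨natDegree_mul_le_of_le h3 h1, by rw [coeff_mul_add_eq_of_natDegree_le h3 h1, h2]⟩

open Polynomial in
/-- If the entries of the column `j` have degree at most `d j`, then the determinant has degree at
most `∑ d j`, and the corresponding coefficient is the determinant of the top coefficients. -/
lemma natDegree_det_le_and_coeff {R ι : Type*} [CommRing R] [Fintype ι] [DecidableEq ι]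
    (M : Matrix ι ι R[X]) (d : ι → ℕ) (h : ∀ i j, (M i j).natDegree ≤ d j) :
    M.det.natDegree ≤ ∑ j, d j ∧
      M.det.coeff (∑ j, d j) = (Matrix.of fun i j => (M i j).coeff (d j)).det := by
  have key := fun σ : Equiv.Perm ι => natDegree_prod_le_and_coeff Finset.univ
    (fun j => M (σ j) j) d fun j _ => h _ _
  constructor
  · rw [Matrix.det_apply]
    refine natDegree_sum_le_of_forall_le _ _ fun σ _ => ?_
    exact (natDegree_smul_le _ _).trans (key σ).1
  · rw [Matrix.det_apply, Matrix.det_apply, finsetSum_coeff]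
    refine Finset.sum_congr rfl fun σ _ => ?_
    rw [coeff_smul, (key σ).2]
    rfl

-- Over ℂ the polynomial splits, and since 0 is not a root every root has a logarithm. Listing the
-- roots with multiplicity gives exactly n constants.
open Polynomial in
lemma exists_exp_factorization {n : ℕ} {F : ℂ[X]} (hF : F.natDegree = n) (h0 : F.eval 0 ≠ 0)
    {l₀ : ℝ} (hl₀ : 0 < l₀) :
    ∃ (c : Fin n → ℂ) (A : ℂ), A ≠ 0 ∧
      ∀ w, F.eval w = A * ∏ s, (w - Complex.exp (l₀ * c s)) := by
  have hF0 : F ≠ 0 := by rintro rfl; simp at h0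
  have hl : (l₀ : ℂ) ≠ 0 := by exact_mod_cast hl₀.ne'
  have hcard : F.roots.toList.length = n := by
    rw [Multiset.length_toList, ← hF]
    exact (IsAlgClosed.splits F).natDegree_eq_card_roots.symm
  subst hcard
  refine ⟨fun s => Complex.log (F.roots.toList.get s) / l₀, F.leadingCoeff,
    leadingCoeff_ne_zero.2 hF0, fun w => ?_⟩
  have hexp : ∀ s, Complex.exp (l₀ * (Complex.log (F.roots.toList.get s) / l₀)) =
      F.roots.toList.get s := fun s => by
    rw [mul_div_cancel₀ _ hl, Complex.exp_log]
    intro hz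
    have hmem : F.roots.toList.get s ∈ F.roots :=
      Multiset.mem_toList.1 (List.get_mem _ _)
    rw [hz, mem_roots hF0] at hmem
    exact h0 hmem
  simp only [hexp]
  conv_lhs => rw [(IsAlgClosed.splits F).eq_prod_roots]
  rw [eval_mul, eval_C, eval_multiset_prod, Multiset.map_map]
  congr 1
  conv_lhs => rw [← Multiset.coe_toList F.roots]
  rw [Multiset.map_coe, Multiset.prod_coe, ← List.prod_ofFn]
  congr 1
  conv_lhs => rw [← List.ofFn_get F.roots.toList]
  rw [List.map_ofFn]
  congr 1
  ext s
  simp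

/-! ### The coupling condition at high frequency. -/

open scoped ComplexOrder in
/-- The projection `P` onto the kernel of `U + 1` along its range, for a unitary matrix `U`,
together with the inverse `W` of `U + 1 + P`. -/
lemma exists_kernel_projection {n : Type*} [Fintype n] [DecidableEq n] {U : Matrix n n ℂ}
    (hU : U ∈ Matrix.unitaryGroup n ℂ) :
    ∃ P W : Matrix n n ℂ, P * P = P ∧ (U + 1) * P = 0 ∧ P * (U + 1) = 0 ∧
      W * (U + 1 + P) = 1 := by
  set f : (n → ℂ) →ₗ[ℂ] (n → ℂ) := Matrix.toLin' (U + 1) with hf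
  -- Unitarity turns Uy = -y into U*y = -y, so y is orthogonal to the range of U + 1; if y also lies
  -- in that range, it vanishes. In finite dimension disjointness makes the two subspaces
  -- complementary.
  have hdisj : Disjoint (LinearMap.ker f) (LinearMap.range f) := by
    rw [Submodule.disjoint_def]
    rintro y hy ⟨x, rfl⟩
    set y := f x with hyx
    have h1 : U.mulVec y = -y := by
      rw [LinearMap.mem_ker, hf, Matrix.toLin'_apply, Matrix.add_mulVec, Matrix.one_mulVec] at hy
      exact eq_neg_of_add_eq_zero_left hy
    have h2 : (star U).mulVec y = -y := by
      have : (star U).mulVec (U.mulVec y) = y := by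
        rw [Matrix.mulVec_mulVec, (Matrix.mem_unitaryGroup_iff').1 hU, Matrix.one_mulVec]
      rw [h1, Matrix.mulVec_neg] at this
      exact neg_eq_iff_eq_neg.1 this
    have h3 : star y ⬝ᵥ y = 0 := by
      have h5 : star y ⬝ᵥ y = star y ⬝ᵥ (U + 1).mulVec x := rfl
      rw [h5, Matrix.dotProduct_mulVec]
      have : Matrix.vecMul (star y) (U + 1) = 0 := by
        have h4 := congrArg star h2
        rw [Matrix.star_mulVec, Matrix.star_eq_conjTranspose,
          Matrix.conjTranspose_conjTranspose, star_neg] at h4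
        rw [Matrix.vecMul_add, h4, Matrix.vecMul_one, neg_add_cancel]
      rw [this, zero_dotProduct]
    exact dotProduct_star_self_eq_zero.1 h3
  have hc : IsCompl (LinearMap.ker f) (LinearMap.range f) := by
    refine ⟨hdisj, codisjoint_iff.2 (Submodule.eq_top_of_disjoint _ _ ?_ hdisj)⟩
    rw [add_comm, LinearMap.finrank_range_add_finrank_ker]
  set π := (LinearMap.ker f).projection (LinearMap.range f) hc with hπ
  have e1 : π ∘ₗ π = π := by
    refine LinearMap.ext fun x => ?_
    exact Submodule.projection_apply_left hc ⟨π _, Submodule.projection_apply_mem hc _⟩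
  have e2 : f ∘ₗ π = 0 := by
    refine LinearMap.ext fun x => ?_
    exact LinearMap.mem_ker.1 (Submodule.projection_apply_mem hc _)
  have e3 : π ∘ₗ f = 0 := by
    refine LinearMap.ext fun x => ?_
    exact (Submodule.projection_apply_eq_zero_iff hc).2 (LinearMap.mem_range_self f _)
  have hfm : LinearMap.toMatrix' f = U + 1 := LinearMap.toMatrix'_toLin' _
  have p1 := congrArg LinearMap.toMatrix' e1
  have p2 := congrArg LinearMap.toMatrix' e2
  have p3 := congrArg LinearMap.toMatrix' e3
  rw [LinearMap.toMatrix'_comp] at p1 p2 p3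
  rw [hfm, map_zero] at p2 p3
  set P := LinearMap.toMatrix' π with hP
  have hinj : Function.Injective (U + 1 + P).mulVec := by
    have : Function.Injective (Matrix.toLin' (U + 1 + P)) := by
      rw [← LinearMap.ker_eq_bot, LinearMap.ker_eq_bot']
      intro x hx
      rw [Matrix.toLin'_apply] at hx
      have q1 : P.mulVec x = 0 := by
        have := congrArg P.mulVec hx
        rwa [Matrix.mulVec_mulVec, Matrix.mul_add, p3, p1, zero_add, Matrix.mulVec_zero] at this
      have q2 : (U + 1).mulVec x = 0 := by
        rwa [Matrix.add_mulVec, q1, add_zero] at hx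
      have q3 : π x = x := Submodule.projection_apply_left hc ⟨x, LinearMap.mem_ker.2 (by
        rw [hf, Matrix.toLin'_apply, q2])⟩
      rw [← q3, ← Matrix.toLin'_toMatrix' π, Matrix.toLin'_apply, ← hP, q1]
    exact this
  obtain ⟨W, hW⟩ := (Matrix.mulVec_injective_iff_isUnit.1 hinj).exists_left_inv
  exact ⟨P, W, p1, p2, p3, hW⟩

/-- Normalization of the coupling condition in terms of outgoing and incoming amplitudes. -/
lemma exists_coupling_normalization {n : Type*} [Fintype n] [DecidableEq n] {U : Matrix n n ℂ}
    (hU : U ∈ Matrix.unitaryGroup n ℂ) :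
    ∃ P E : Matrix n n ℂ, P * P = P ∧ ∀ w : ℂ, w ≠ 0 → ∃ K : Matrix n n ℂ, IsUnit K ∧
      K * ((U - 1) + w • (U + 1)) = 1 + w⁻¹ • E ∧
      K * ((U - 1) - w • (U + 1)) = -(1 - 2 • P) + w⁻¹ • E := by
  obtain ⟨P, W, h1, h2, h3, h4⟩ := exists_kernel_projection hU
  have hWP : W * P = P := by
    calc W * P = W * ((U + 1 + P) * P) := by rw [add_mul, h2, h1, zero_add]
      _ = P := by rw [← mul_assoc, h4, one_mul]
  have hWU : W * (U + 1) = 1 - P := by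
    rw [mul_add, hWP] at h4
    exact eq_sub_of_add_eq h4
  refine ⟨P, 1 + P - 2 • W, h1, fun w hw => ?_⟩
  -- On ker(U + 1) the matrix (U - 1) ± w(U + 1) is -2 and needs the factor -1/2; elsewhere w(U + 1)
  -- dominates and needs w⁻¹ times the inverse of U + 1, which W - P supplies because (W - P)(U + 1)
  -- = 1 - P.
  set K := (-(1 / 2) : ℂ) • P + w⁻¹ • (W - P) with hK
  have k1 : K * (U + 1) = w⁻¹ • (1 - P) := by
    rw [hK, add_mul, smul_mul_assoc, h3, smul_zero, zero_add, smul_mul_assoc, sub_mul, h3, hWU,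
      sub_zero]
  have k2 : K * (U - 1) = P + w⁻¹ • (1 + P - 2 • W) := by
    have : U - 1 = (U + 1) - (2 : ℂ) • (1 : Matrix n n ℂ) := by
      rw [two_smul]; abel
    rw [this, mul_sub, k1, mul_smul_comm, mul_one, hK]
    module
  refine ⟨K, ?_, ?_, ?_⟩
  · have hinv : K * ((U + 1 + P) * ((-2 : ℂ) • P + w • (1 - P))) = 1 := by
      have : K * (U + 1 + P) = (-(1 / 2) : ℂ) • P + w⁻¹ • (1 - P) := by
        rw [mul_add, k1, hK, add_mul, smul_mul_assoc, smul_mul_assoc, sub_mul, hWP, h1, sub_self]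
        module
      rw [← mul_assoc, this]
      simp only [add_mul, mul_add, smul_mul_assoc, mul_smul_comm, sub_mul, mul_sub, h1, one_mul,
        mul_one, sub_self, smul_zero, add_zero, smul_smul]
      match_scalars
      · field_simp
        ring
      · field_simp
    exact IsUnit.of_mul_eq_one _ hinv
  · rw [mul_add, mul_smul_comm, k1, k2, smul_smul, mul_inv_cancel₀ hw]
    module
  · rw [mul_sub, mul_smul_comm, k1, k2, smul_smul, mul_inv_cancel₀ hw]
    module

/-! ### Volterra operators and the transfer matrix of an edge. -/

lemma integrableOn_of_bounded_continuousOn {E : Type*} [NormedAddCommGroup E] {l : ℝ}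
    {g : ℝ → E} (hg : ContinuousOn g (Set.Ioo 0 l)) {C : ℝ}
    (hC : ∀ x ∈ Set.Ioo 0 l, ‖g x‖ ≤ C) : IntegrableOn g (Set.Ioo 0 l) := by
  refine IntegrableOn.of_bound measure_Ioo_lt_top (hg.aestronglyMeasurable measurableSet_Ioo) C ?_
  exact (ae_restrict_iff' measurableSet_Ioo).2 (Eventually.of_forall hC)

lemma intervalIntegrable_of_bounded_continuousOn {E : Type*} [NormedAddCommGroup E] {l : ℝ}
    (hl : 0 ≤ l) {g : ℝ → E} (hg : ContinuousOn g (Set.Ioo 0 l)) {C : ℝ}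
    (hC : ∀ x ∈ Set.Ioo 0 l, ‖g x‖ ≤ C) : IntervalIntegrable g volume 0 l := by
  rw [intervalIntegrable_iff_integrableOn_Ioo_of_le hl]
  exact integrableOn_of_bounded_continuousOn hg hC

lemma IntervalIntegrable.mono_Icc {E : Type*} [NormedAddCommGroup E] {l x : ℝ} {g : ℝ → E}
    (hg : IntervalIntegrable g volume 0 l) (hx : x ∈ Set.Icc 0 l) :
    IntervalIntegrable g volume 0 x :=
  hg.mono_set (by
    rw [Set.uIcc_of_le hx.1, Set.uIcc_of_le (hx.1.trans hx.2)]
    exact Set.Icc_subset_Icc_right hx.2)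

lemma IntervalIntegrable.mul_extend {l : ℝ} (hl : 0 ≤ l) {k : ℝ → ℂ}
    (hk : IntervalIntegrable k volume 0 l) (f : C(Set.Icc 0 l, ℂ)) :
    IntervalIntegrable (fun t => k t * Set.IccExtend hl f t) volume 0 l :=
  hk.mul_continuousOn (f.continuous.Icc_extend' (h := hl)).continuousOn

lemma continuous_primitive_extend {l : ℝ} (hl : 0 ≤ l) {k : ℝ → ℂ}
    (hk : IntervalIntegrable k volume 0 l) (f : C(Set.Icc 0 l, ℂ)) :
    Continuous fun x : Set.Icc 0 l => ∫ t in (0 : ℝ)..x, k t * Set.IccExtend hl f t := by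
  have := intervalIntegral.continuousOn_primitive_interval'
    (hk.mul_extend hl f) (Set.left_mem_uIcc)
  rw [Set.uIcc_of_le hl] at this
  exact continuousOn_iff_continuous_domRestrict.1 this

/-- The integral operator `f ↦ ∫₀ˣ k f` on the continuous functions on `[0, l]`. -/
noncomputable def volterra {l : ℝ} (hl : 0 ≤ l) (k : ℝ → ℂ)
    (hk : IntervalIntegrable k volume 0 l) : C(Set.Icc 0 l, ℂ) →L[ℂ] C(Set.Icc 0 l, ℂ) :=
  LinearMap.mkContinuous
    { toFun := fun f => ⟨fun x => ∫ t in (0 : ℝ)..x, k t * Set.IccExtend hl f t,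
        continuous_primitive_extend hl hk f⟩
      map_add' := fun f g => by
        ext x
        simp only [ContinuousMap.coe_mk, ContinuousMap.add_apply]
        rw [← intervalIntegral.integral_add ((hk.mul_extend hl f).mono_Icc x.2)
          ((hk.mul_extend hl g).mono_Icc x.2)]
        refine intervalIntegral.integral_congr fun t _ => ?_
        simp [Set.IccExtend, mul_add]
      map_smul' := fun c f => by
        ext x
        simp only [ContinuousMap.coe_mk, ContinuousMap.smul_apply, RingHom.id_apply, smul_eq_mul]
        rw [← intervalIntegral.integral_const_mul]
        refine intervalIntegral.integral_congr fun t _ => ?_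
        simp only [Set.IccExtend, Function.comp, ContinuousMap.smul_apply, smul_eq_mul]
        ring }
    (∫ t in (0 : ℝ)..l, ‖k t‖) (fun f => by
      have h0 : 0 ≤ ∫ t in (0 : ℝ)..l, ‖k t‖ :=
        intervalIntegral.integral_nonneg hl fun _ _ => norm_nonneg _
      rw [ContinuousMap.norm_le _ (mul_nonneg h0 (norm_nonneg f))]
      intro x
      simp only [LinearMap.coe_mk, AddHom.coe_mk, ContinuousMap.coe_mk]
      calc ‖∫ t in (0 : ℝ)..x, k t * Set.IccExtend hl f t‖
          ≤ ∫ t in (0 : ℝ)..x, ‖k t‖ * ‖f‖ := by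
            refine intervalIntegral.norm_integral_le_of_norm_le x.2.1
              (Eventually.of_forall fun t _ => ?_) ((hk.mono_Icc x.2).norm.mul_const _)
            rw [norm_mul]
            gcongr
            exact f.norm_coe_le_norm _
        _ ≤ ∫ t in (0 : ℝ)..l, ‖k t‖ * ‖f‖ :=
            intervalIntegral.integral_mono_interval le_rfl x.2.1 x.2.2
              (Eventually.of_forall fun t => by positivity) (hk.norm.mul_const _)
        _ = _ := intervalIntegral.integral_mul_const _ _)

lemma volterra_apply {l : ℝ} (hl : 0 ≤ l) {k : ℝ → ℂ} (hk : IntervalIntegrable k volume 0 l)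
    (f : C(Set.Icc 0 l, ℂ)) (x : Set.Icc 0 l) :
    volterra hl k hk f x = ∫ t in (0 : ℝ)..x, k t * Set.IccExtend hl f t := rfl

lemma norm_volterra_apply_le {l : ℝ} (hl : 0 ≤ l) {k : ℝ → ℂ}
    (hk : IntervalIntegrable k volume 0 l) {C : ℝ} (hC : ∀ x ∈ Set.Ioo 0 l, ‖k x‖ ≤ C)
    {f : C(Set.Icc 0 l, ℂ)} {A : ℝ} {n : ℕ}
    (hf : ∀ x, ‖f x‖ ≤ A * ((x : ℝ) ^ n / n.factorial)) (x : Set.Icc 0 l) :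
    ‖volterra hl k hk f x‖ ≤ C * A * ((x : ℝ) ^ (n + 1) / (n + 1).factorial) := by
  rw [volterra_apply]
  have hintegral : ∫ t in (0 : ℝ)..x, C * (A * (t ^ n / n.factorial)) =
      C * A * ((x : ℝ) ^ (n + 1) / (n + 1).factorial) := by
    simp only [intervalIntegral.integral_const_mul, intervalIntegral.integral_div, integral_pow]
    rw [Nat.factorial_succ]
    push_cast
    have : (n.factorial : ℝ) ≠ 0 := by positivity
    field_simp
    simp
  rw [← hintegral]
  refine intervalIntegral.norm_integral_le_of_norm_le x.2.1 ?_
    (Continuous.intervalIntegrable (by fun_prop) _ _)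
  -- The coefficient is bounded only on the open edge, so the end point l, which belongs to the
  -- range of integration when x = l, is discarded as a null set.
  have hne : ∀ᵐ t : ℝ, t ≠ l := Measure.ae_ne volume l
  filter_upwards [hne] with t ht htx
  have htl : t ∈ Set.Icc 0 l := ⟨htx.1.le, htx.2.trans x.2.2⟩
  rw [norm_mul, Set.IccExtend_of_mem hl _ htl]
  have := hC t ⟨htx.1, lt_of_le_of_ne htl.2 ht⟩
  exact mul_le_mul this (hf ⟨t, htl⟩) (norm_nonneg _) ((norm_nonneg _).trans this)

/-- Iterated kernels decay factorially, so some power Vⁿ has norm below 1 although V itself need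
not. Then 1 - Vⁿ is invertible, and 1 - V is one of its commuting factors. -/
lemma isUnit_one_sub_volterra {l : ℝ} (hl : 0 ≤ l) {k : ℝ → ℂ}
    (hk : IntervalIntegrable k volume 0 l) {C : ℝ} (hC : ∀ x ∈ Set.Ioo 0 l, ‖k x‖ ≤ C)
    (h1 : IntervalIntegrable (fun _ => (1 : ℂ)) volume 0 l) (hC0 : 0 ≤ C) :
    IsUnit (1 - volterra hl _ h1 * volterra hl k hk) := by
  set V := volterra hl _ h1 * volterra hl k hk with hV
  have hpow : ∀ (n : ℕ) (f : C(Set.Icc 0 l, ℂ)) (x : Set.Icc 0 l),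
      ‖(V ^ n) f x‖ ≤ C ^ n * ‖f‖ * ((x : ℝ) ^ (2 * n) / (2 * n).factorial) := by
    intro n f
    induction n with
    | zero => intro x; simpa using f.norm_coe_le_norm x
    | succ n ih =>
      intro x
      have := norm_volterra_apply_le hl h1 (C := 1) (by simp)
        (norm_volterra_apply_le hl hk hC ih) x
      rw [pow_succ' V]
      refine this.trans (le_of_eq ?_)
      rw [one_mul, pow_succ C, show 2 * (n + 1) = 2 * n + 1 + 1 by ring]
      ring
  have hnorm : ∀ n : ℕ, ‖V ^ n‖ ≤ (C * l ^ 2) ^ n / n.factorial := by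
    intro n
    refine ContinuousLinearMap.opNorm_le_bound _ (by positivity) fun f => ?_
    rw [ContinuousMap.norm_le _ (by positivity)]
    intro x
    refine (hpow n f x).trans ?_
    have hx := x.2
    calc C ^ n * ‖f‖ * ((x : ℝ) ^ (2 * n) / (2 * n).factorial)
        ≤ C ^ n * ‖f‖ * (l ^ (2 * n) / n.factorial) := by
          have h2 : (n.factorial : ℝ) ≤ (2 * n).factorial := by
            exact_mod_cast Nat.factorial_le (by omega)
          have h3 : (x : ℝ) ^ (2 * n) ≤ l ^ (2 * n) := pow_le_pow_left₀ hx.1 hx.2 _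
          gcongr
      _ = _ := by rw [mul_pow, ← pow_mul]; ring
  obtain ⟨n, hn⟩ := ((FloorSemiring.tendsto_pow_div_factorial_atTop (C * l ^ 2)).eventually
    (gt_mem_nhds one_pos)).exists
  have hu : IsUnit (1 - V ^ n) := isUnit_one_sub_of_norm_lt_one (R := C(Set.Icc 0 l, ℂ) →L[ℂ] C(Set.Icc 0 l, ℂ))
    (x := V ^ n) ((hnorm n).trans_lt hn)
  have e1 : (1 - V) * ∑ i ∈ Finset.range n, V ^ i = 1 - V ^ n := mul_neg_geom_sum V n
  have e2 : (∑ i ∈ Finset.range n, V ^ i) * (1 - V) = 1 - V ^ n := geom_sum_mul_neg V n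
  have hcomm : Commute (1 - V) (∑ i ∈ Finset.range n, V ^ i) := by
    rw [commute_iff_eq, e1, e2]
  rw [← e1] at hu
  exact (hcomm.isUnit_mul_iff.1 hu).1

/-- `u` with derivative `du` solves `u'' = k u` on `[0, l]`, in integrated form. -/
structure IsEdgeSolution (l : ℝ) (k u du : ℝ → ℂ) : Prop where
  continuousOn_fst : ContinuousOn u (Set.Icc 0 l)
  continuousOn_snd : ContinuousOn du (Set.Icc 0 l)
  snd_eq : ∀ x ∈ Set.Icc 0 l, du x = du 0 + ∫ t in (0 : ℝ)..x, k t * u t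
  fst_eq : ∀ x ∈ Set.Icc 0 l, u x = u 0 + ∫ t in (0 : ℝ)..x, du t

/-- The initial value problem in terms of the Volterra operators. -/
lemma IsEdgeSolution.volterra_eq {l : ℝ} (hl : 0 ≤ l) {k u du : ℝ → ℂ}
    (hk : IntervalIntegrable k volume 0 l)
    (h1 : IntervalIntegrable (fun _ => (1 : ℂ)) volume 0 l) (h : IsEdgeSolution l k u du) :
    ∃ f : C(Set.Icc 0 l, ℂ), (∀ x, f x = u x) ∧
      (1 - volterra hl _ h1 * volterra hl k hk) f =
        u 0 • (1 : C(Set.Icc 0 l, ℂ)) + du 0 • ⟨fun x => ((x : ℝ) : ℂ), by fun_prop⟩ ∧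
      ∀ x : Set.Icc 0 l, du x = du 0 + volterra hl k hk f x := by
  set f : C(Set.Icc 0 l, ℂ) := ⟨fun x => u x, h.continuousOn_fst.domRestrict⟩ with hf
  have hdu : ∀ x : Set.Icc 0 l, du x = du 0 + volterra hl k hk f x := fun x => by
    rw [h.snd_eq x x.2, volterra_apply]
    congr 1
    refine intervalIntegral.integral_congr fun t ht => ?_
    rw [Set.uIcc_of_le x.2.1] at ht
    rw [Set.IccExtend_of_mem hl _ ⟨ht.1, ht.2.trans x.2.2⟩]
    rfl
  refine ⟨f, fun _ => rfl, ?_, hdu⟩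
  ext x
  simp only [_root_.sub_apply, one_apply_eq_self,
    mul_apply_eq_comp, ContinuousMap.sub_apply, ContinuousMap.add_apply,
    ContinuousMap.smul_apply, ContinuousMap.one_apply, smul_eq_mul, mul_one, ContinuousMap.coe_mk]
  rw [show f x = u x from rfl, h.fst_eq x x.2, volterra_apply]
  have : ∫ t in (0 : ℝ)..x, du t = ∫ t in (0 : ℝ)..x,
      (du 0 + 1 * Set.IccExtend hl (volterra hl k hk f) t) := by
    refine intervalIntegral.integral_congr fun t ht => ?_
    rw [Set.uIcc_of_le x.2.1] at ht
    have htl : t ∈ Set.Icc 0 l := ⟨ht.1, ht.2.trans x.2.2⟩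
    simp only [one_mul]
    rw [Set.IccExtend_of_mem hl _ htl]
    exact hdu ⟨t, htl⟩
  rw [this, intervalIntegral.integral_add (by simp)
    ((h1.mul_extend hl _).mono_Icc x.2), intervalIntegral.integral_const]
  simp
  ring

/-- Inverting the Volterra equation yields u; the derivative is then recovered as v₀ + ∫ k u. No
continuity of k at the ends of the edge is needed. -/
lemma exists_isEdgeSolution {l : ℝ} (hl : 0 ≤ l) {k : ℝ → ℂ}
    (hk : IntervalIntegrable k volume 0 l)
    (h1 : IntervalIntegrable (fun _ => (1 : ℂ)) volume 0 l)
    (hu : IsUnit (1 - volterra hl _ h1 * volterra hl k hk)) (u₀ v₀ : ℂ) :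
    ∃ u du, IsEdgeSolution l k u du ∧ u 0 = u₀ ∧ du 0 = v₀ := by
  obtain ⟨R, hR⟩ := hu.exists_right_inv
  set g : C(Set.Icc 0 l, ℂ) := u₀ • (1 : C(Set.Icc 0 l, ℂ)) +
    v₀ • ⟨fun x => ((x : ℝ) : ℂ), by fun_prop⟩ with hg
  set f := R g with hf
  have hfg : f = g + volterra hl _ h1 (volterra hl k hk f) := by
    have := DFunLike.congr_fun hR g
    rw [mul_apply_eq_comp, _root_.sub_apply] at this
    exact sub_eq_iff_eq_add.1 this
  set dux : ℝ → ℂ := fun x => v₀ + Set.IccExtend hl (volterra hl k hk f) x with hdux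
  have hv0 : volterra hl k hk f ⟨0, Set.left_mem_Icc.2 hl⟩ = 0 := by
    rw [volterra_apply]; simp
  have hdc : Continuous dux :=
    continuous_const.add ((volterra hl k hk f).continuous.Icc_extend' (h := hl))
  have hd0 : dux 0 = v₀ := by
    rw [hdux]
    simp only
    rw [Set.IccExtend_of_mem hl _ (Set.left_mem_Icc.2 hl), hv0, add_zero]
  have hfx : ∀ x (hx : x ∈ Set.Icc 0 l), f ⟨x, hx⟩ = u₀ + ∫ t in (0 : ℝ)..x, dux t := by
    intro x hx
    rw [hfg]
    have : ∫ t in (0 : ℝ)..x, dux t = v₀ * x + volterra hl _ h1 (volterra hl k hk f) ⟨x, hx⟩ := by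
      rw [volterra_apply, hdux, intervalIntegral.integral_add (by simp)
        (((volterra hl k hk f).continuous.Icc_extend' (h := hl)).intervalIntegrable _ _)]
      simp
      ring
    rw [this, hg]
    simp
    ring
  have hf0 : f ⟨0, Set.left_mem_Icc.2 hl⟩ = u₀ := by rw [hfx]; simp
  have hu0 : Set.IccExtend hl f 0 = u₀ := by
    rw [Set.IccExtend_of_mem hl _ (Set.left_mem_Icc.2 hl), hf0]
  refine ⟨Set.IccExtend hl f, dux, ⟨(f.continuous.Icc_extend' (h := hl)).continuousOn,
    hdc.continuousOn, fun x hx => ?_, fun x hx => ?_⟩, hu0, hd0⟩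
  · rw [hd0, hdux]
    simp only
    rw [Set.IccExtend_of_mem hl _ hx, volterra_apply]
  · rw [hu0, Set.IccExtend_of_mem hl _ hx, hfx]

/-- Matrix elements of `(1 - V J(z))⁻¹` and of `J(z) (1 - V J(z))⁻¹` for a quadratic operator
pencil `J` are entire functions. -/
lemma differentiable_resolvent {E : Type*} [NormedAddCommGroup E] [NormedSpace ℂ E]
    [CompleteSpace E] (V A B : E →L[ℂ] E) {J : ℂ → E →L[ℂ] E}
    (hJ : ∀ z, J z = z ^ 2 • V + (2 * z) • A - B) (hu : ∀ z, IsUnit (1 - V * J z))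
    (φ : E →L[ℂ] ℂ) (g : E) :
    Differentiable ℂ (fun z => φ (Ring.inverse (1 - V * J z) g)) ∧
      Differentiable ℂ (fun z => φ (J z (Ring.inverse (1 - V * J z) g))) := by
  have hJd : Differentiable ℂ J := by
    rw [funext hJ]
    fun_prop
  have hR : Differentiable ℂ fun z => Ring.inverse (1 - V * J z) := fun z =>
    DifferentiableAt.inverse (by fun_prop) (hu z)
  constructor <;> fun_prop

/-- The transfer matrix of an edge, an entire function of the spectral parameter. -/
theorem exists_transfer_matrix {l : ℝ} (hl : 0 ≤ l) {a b : ℝ → ℝ} {C : ℝ} (hC0 : 0 ≤ C)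
    (ha : ContinuousOn a (Set.Ioo 0 l)) (hb : ContinuousOn b (Set.Ioo 0 l))
    (haC : ∀ x ∈ Set.Ioo 0 l, |a x| ≤ C) (hbC : ∀ x ∈ Set.Ioo 0 l, |b x| ≤ C) :
    ∃ T : ℂ → Matrix (Fin 2) (Fin 2) ℂ, (∀ i j, Differentiable ℂ fun z => T z i j) ∧
      (∀ z u du, IsEdgeSolution l (fun x => z ^ 2 + 2 * z * a x - b x) u du →
        u l = T z 0 0 * u 0 + T z 0 1 * du 0 ∧ du l = T z 1 0 * u 0 + T z 1 1 * du 0) ∧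
      (∀ z u₀ v₀, ∃ u du, IsEdgeSolution l (fun x => z ^ 2 + 2 * z * a x - b x) u du ∧
        u 0 = u₀ ∧ du 0 = v₀) ∧
      (∀ z u du, IsEdgeSolution l (fun x => z ^ 2 + 2 * z * a x - b x) u du →
        u 0 = 0 → du 0 = 0 → ∀ x ∈ Set.Icc 0 l, u x = 0) := by
  have h1 : IntervalIntegrable (fun _ => (1 : ℂ)) volume 0 l := by simp
  have hA : IntervalIntegrable (fun x => (a x : ℂ)) volume 0 l :=
    intervalIntegrable_of_bounded_continuousOn hl (Complex.continuous_ofReal.comp_continuousOn ha)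
      (C := C) (by simpa using haC)
  have hB : IntervalIntegrable (fun x => (b x : ℂ)) volume 0 l :=
    intervalIntegrable_of_bounded_continuousOn hl (Complex.continuous_ofReal.comp_continuousOn hb)
      (C := C) (by simpa using hbC)
  have hk : ∀ z : ℂ, IntervalIntegrable (fun x => z ^ 2 + 2 * z * a x - b x) volume 0 l :=
    fun z => (IntervalIntegrable.add (by simp) (hA.const_mul _)).sub hB
  have hunit : ∀ z : ℂ, IsUnit (1 - volterra hl _ h1 * volterra hl _ (hk z)) := fun z => by
    refine isUnit_one_sub_volterra hl (hk z) (C := ‖z‖ ^ 2 + 2 * ‖z‖ * C + C) (fun x hx => ?_) h1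
      (by positivity)
    refine (norm_sub_le _ _).trans (add_le_add ((norm_add_le _ _).trans (add_le_add ?_ ?_)) ?_)
    · simp
    · simp only [norm_mul, Complex.norm_real, Real.norm_eq_abs, Complex.norm_ofNat]
      gcongr
      exact haC x hx
    · simpa using hbC x hx
  -- The Volterra operator is linear in its kernel and the kernel is quadratic in z; this is what
  -- makes the inverse, and with it the transfer matrix, entire.
  have hlin : ∀ z : ℂ, volterra hl _ (hk z) = z ^ 2 • volterra hl _ h1 +
      (2 * z) • volterra hl _ hA - volterra hl _ hB := fun z => by
    ext f x
    simp only [_root_.sub_apply, _root_.add_apply,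
      _root_.smul_apply, ContinuousMap.sub_apply, ContinuousMap.add_apply,
      ContinuousMap.smul_apply, smul_eq_mul, volterra_apply]
    rw [← intervalIntegral.integral_const_mul, ← intervalIntegral.integral_const_mul,
      ← intervalIntegral.integral_add (((h1.mul_extend hl f).mono_Icc x.2).const_mul _)
        (((hA.mul_extend hl f).mono_Icc x.2).const_mul _),
      ← intervalIntegral.integral_sub ((((h1.mul_extend hl f).mono_Icc x.2).const_mul _).add
        (((hA.mul_extend hl f).mono_Icc x.2).const_mul _)) ((hB.mul_extend hl f).mono_Icc x.2)]
    refine intervalIntegral.integral_congr fun t _ => ?_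
    ring
  set R : ℂ → C(Set.Icc 0 l, ℂ) →L[ℂ] C(Set.Icc 0 l, ℂ) := fun z =>
    Ring.inverse (1 - volterra hl _ h1 * volterra hl _ (hk z)) with hR
  set X : C(Set.Icc 0 l, ℂ) := ⟨fun x => ((x : ℝ) : ℂ), by fun_prop⟩ with hX
  have hll : l ∈ Set.Icc 0 l := ⟨hl, le_rfl⟩
  set ev : C(Set.Icc 0 l, ℂ) →L[ℂ] ℂ := ContinuousMap.evalCLM ℂ ⟨l, hll⟩ with hev
  have hsol : ∀ z u du, IsEdgeSolution l (fun x => z ^ 2 + 2 * z * a x - b x) u du →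
      ∃ f : C(Set.Icc 0 l, ℂ), (∀ x, f x = u x) ∧ f = u 0 • R z 1 + du 0 • R z X ∧
        ∀ x : Set.Icc 0 l, du x = du 0 + volterra hl _ (hk z) f x := by
    intro z u du h
    obtain ⟨f, hfu, hf, hfd⟩ := h.volterra_eq hl (hk z) h1
    refine ⟨f, hfu, ?_, hfd⟩
    have : R z ((1 - volterra hl _ h1 * volterra hl _ (hk z)) f) = f := by
      rw [← mul_apply_eq_comp, hR]
      simp only
      rw [Ring.inverse_mul_cancel _ (hunit z), one_apply_eq_self]
    rw [← this, hf, map_add, map_smul, map_smul]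
  refine ⟨fun z => !![ev (R z 1), ev (R z X); ev (volterra hl _ (hk z) (R z 1)),
    1 + ev (volterra hl _ (hk z) (R z X))], ?_, ?_, ?_, ?_⟩
  · have hd := differentiable_resolvent _ _ _ hlin hunit ev
    intro i j
    fin_cases i <;> fin_cases j
    · exact (hd 1).1
    · exact (hd X).1
    · exact (hd 1).2
    · exact (hd X).2.const_add 1
  · intro z u du h
    obtain ⟨f, hfu, hf, hfd⟩ := hsol z u du h
    have e1 : u l = ev f := (hfu ⟨l, hll⟩).symm
    have e2 : du l = du 0 + ev (volterra hl _ (hk z) f) := hfd ⟨l, hll⟩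
    rw [e1, e2, hf]
    simp only [map_add, map_smul, smul_eq_mul, Matrix.of_apply, Matrix.cons_val', Matrix.cons_val_zero,
      Matrix.cons_val_one, Matrix.cons_val_fin_one]
    constructor <;> ring
  · exact fun z u₀ v₀ => exists_isEdgeSolution hl (hk z) h1 (hunit z) u₀ v₀
  · intro z u du h h0 h0' x hx
    obtain ⟨f, hfu, hf, -⟩ := hsol z u du h
    rw [← hfu ⟨x, hx⟩, hf, h0, h0']
    simp

/-! ### Edge solutions, the flux identity and the strip containing the non-real eigenvalues. -/

lemma hasDerivAt_primitive_of_mem_Ioo {l : ℝ} {g : ℝ → ℂ} (hg : ContinuousOn g (Set.Ioo 0 l))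
    (hi : IntervalIntegrable g volume 0 l) {x : ℝ} (hx : x ∈ Set.Ioo 0 l) :
    HasDerivAt (fun y => ∫ t in (0 : ℝ)..y, g t) (g x) x :=
  intervalIntegral.integral_hasDerivAt_right (hi.mono_Icc (Set.Ioo_subset_Icc_self hx))
    (hg.stronglyMeasurableAtFilter isOpen_Ioo x hx) (hg.continuousAt (isOpen_Ioo.mem_nhds hx))

lemma continuousOn_primitive_Icc {l : ℝ} (hl : 0 ≤ l) {g : ℝ → ℂ}
    (hi : IntervalIntegrable g volume 0 l) :
    ContinuousOn (fun y => ∫ t in (0 : ℝ)..y, g t) (Set.Icc 0 l) := by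
  have := intervalIntegral.continuousOn_primitive_interval' hi Set.left_mem_uIcc
  rwa [Set.uIcc_of_le hl] at this

/-- Inserting the equation, valid almost everywhere, under the integral sign eliminates the weak
second derivative; afterwards only continuous functions and integrals occur. -/
lemma IsSobolevW22.isEdgeSolution {l : ℝ} (hl : 0 ≤ l) {k u du ddu : ℝ → ℂ}
    (h : IsSobolevW22 l u du ddu)
    (hk : ∀ᵐ x ∂(volume.restrict (Set.Ioo 0 l)), ddu x - k x * u x = 0) :
    IsEdgeSolution l k u du := by
  obtain ⟨h1, h2, h3⟩ := h
  have hi : IntervalIntegrable ddu volume 0 l := by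
    rw [intervalIntegrable_iff_integrableOn_Ioo_of_le hl]
    have : Fact (volume (Set.Ioo 0 l) < ⊤) := ⟨measure_Ioo_lt_top⟩
    exact h1.integrable (by norm_num)
  have hdu : ContinuousOn du (Set.Icc 0 l) :=
    (continuousOn_const.add (continuousOn_primitive_Icc hl hi)).congr h2
  have hu : ContinuousOn u (Set.Icc 0 l) :=
    (continuousOn_const.add (continuousOn_primitive_Icc hl
      (hdu.intervalIntegrable_of_Icc hl))).congr h3
  refine ⟨hu, hdu, fun x hx => ?_, h3⟩
  rw [h2 x hx]
  congr 1
  rw [intervalIntegral.integral_of_le hx.1, intervalIntegral.integral_of_le hx.1,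
    integral_Ioc_eq_integral_Ioo, integral_Ioc_eq_integral_Ioo]
  refine integral_congr_ae ?_
  filter_upwards [ae_restrict_of_ae_restrict_of_subset (Set.Ioo_subset_Ioo_right hx.2) hk]
    with t ht using sub_eq_zero.1 ht

namespace IsEdgeSolution

variable {l : ℝ} {k u du : ℝ → ℂ}

lemma continuousOn_mul (h : IsEdgeSolution l k u du) (hk : ContinuousOn k (Set.Ioo 0 l)) :
    ContinuousOn (fun x => k x * u x) (Set.Ioo 0 l) :=
  hk.mul (h.continuousOn_fst.mono Set.Ioo_subset_Icc_self)

lemma exists_bound_mul (h : IsEdgeSolution l k u du) {C : ℝ}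
    (hC : ∀ x ∈ Set.Ioo 0 l, ‖k x‖ ≤ C) : ∃ B, ∀ x ∈ Set.Ioo 0 l, ‖k x * u x‖ ≤ B := by
  obtain ⟨M, hM⟩ := isCompact_Icc.exists_bound_of_continuousOn h.continuousOn_fst
  refine ⟨C * M, fun x hx => ?_⟩
  rw [norm_mul]
  exact mul_le_mul (hC x hx) (hM x (Set.Ioo_subset_Icc_self hx)) (norm_nonneg _)
    ((norm_nonneg _).trans (hC x hx))

lemma isSobolevW22 (h : IsEdgeSolution l k u du) (hk : ContinuousOn k (Set.Ioo 0 l)) {C : ℝ}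
    (hC : ∀ x ∈ Set.Ioo 0 l, ‖k x‖ ≤ C) : IsSobolevW22 l u du (fun x => k x * u x) := by
  obtain ⟨B, hB⟩ := h.exists_bound_mul hC
  refine ⟨?_, h.snd_eq, h.fst_eq⟩
  have : Fact (volume (Set.Ioo 0 l) < ⊤) := ⟨measure_Ioo_lt_top⟩
  exact MemLp.of_bound ((h.continuousOn_mul hk).aestronglyMeasurable measurableSet_Ioo) B
    ((ae_restrict_iff' measurableSet_Ioo).2 (Eventually.of_forall hB))

lemma hasDerivAt_snd (h : IsEdgeSolution l k u du) (hk : ContinuousOn k (Set.Ioo 0 l)) {C : ℝ}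
    (hC : ∀ x ∈ Set.Ioo 0 l, ‖k x‖ ≤ C) {x : ℝ} (hx : x ∈ Set.Ioo 0 l) :
    HasDerivAt du (k x * u x) x := by
  obtain ⟨B, hB⟩ := h.exists_bound_mul hC
  have hl : 0 ≤ l := hx.1.le.trans hx.2.le
  refine ((hasDerivAt_primitive_of_mem_Ioo (h.continuousOn_mul hk)
    (intervalIntegrable_of_bounded_continuousOn hl (h.continuousOn_mul hk) hB) hx).const_add
    (du 0)).congr_of_eventuallyEq ?_
  filter_upwards [isOpen_Ioo.mem_nhds hx] with y hy
  exact h.snd_eq y (Set.Ioo_subset_Icc_self hy)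

lemma hasDerivAt_fst (h : IsEdgeSolution l k u du) {x : ℝ} (hx : x ∈ Set.Ioo 0 l) :
    HasDerivAt u (du x) x := by
  have hl : 0 ≤ l := hx.1.le.trans hx.2.le
  refine ((hasDerivAt_primitive_of_mem_Ioo (h.continuousOn_snd.mono Set.Ioo_subset_Icc_self)
    (h.continuousOn_snd.intervalIntegrable_of_Icc hl) hx).const_add
    (u 0)).congr_of_eventuallyEq ?_
  filter_upwards [isOpen_Ioo.mem_nhds hx] with y hy
  exact h.fst_eq y (Set.Ioo_subset_Icc_self hy)

/-- The flux `Im (star u * du)` is monotone where `Im k` has a sign, and strictly so unless `u = 0`. -/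
lemma flux_le (h : IsEdgeSolution l k u du) (hl : 0 < l) (hk : ContinuousOn k (Set.Ioo 0 l))
    {C : ℝ} (hC : ∀ x ∈ Set.Ioo 0 l, ‖k x‖ ≤ C) {s : ℝ}
    (hs : ∀ x ∈ Set.Ioo 0 l, 0 < s * (k x).im) :
    s * (star (u 0) * du 0).im ≤ s * (star (u l) * du l).im ∧
      (s * (star (u l) * du l).im ≤ s * (star (u 0) * du 0).im →
        ∀ x ∈ Set.Icc 0 l, u x = 0) := by
  set W : ℝ → ℝ := fun x => s * (star (u x) * du x).im with hW
  have hcont : ContinuousOn W (Set.Icc 0 l) :=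
    continuousOn_const.mul (Complex.continuous_im.comp_continuousOn
      ((continuous_star.comp_continuousOn h.continuousOn_fst).mul h.continuousOn_snd))
  -- The derivative of ūu' is |u'|² + k|u|², whose first term is real.
  have hder : ∀ x ∈ Set.Ioo 0 l, HasDerivAt W (s * (k x).im * Complex.normSq (u x)) x := by
    intro x hx
    have h1 := ((h.hasDerivAt_fst hx).star.mul (h.hasDerivAt_snd hk hC hx))
    have h2 := (Complex.imCLM.hasFDerivAt.comp_hasDerivAt x h1).const_mul s
    refine h2.congr_deriv ?_
    simp [Complex.normSq_apply]
    ring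
  have hmono : MonotoneOn W (Set.Icc 0 l) := by
    refine monotoneOn_of_deriv_nonneg (convex_Icc 0 l) hcont ?_ ?_ <;> rw [interior_Icc]
    · exact fun x hx => (hder x hx).differentiableAt.differentiableWithinAt
    · intro x hx
      rw [(hder x hx).deriv]
      exact mul_nonneg (hs x hx).le (Complex.normSq_nonneg _)
  have h0 : (0 : ℝ) ∈ Set.Icc 0 l := Set.left_mem_Icc.2 hl.le
  have hll : l ∈ Set.Icc 0 l := Set.right_mem_Icc.2 hl.le
  refine ⟨hmono h0 hll hl.le, fun hle => ?_⟩
  have hconst : ∀ x ∈ Set.Icc 0 l, W x = W 0 := fun x hx =>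
    le_antisymm ((hmono hx hll hx.2).trans hle) (hmono h0 hx hx.1)
  have hz : Set.EqOn u 0 (Set.Ioo 0 l) := by
    intro x hx
    have h1 : HasDerivAt W 0 x := (hasDerivAt_const x (W 0)).congr_of_eventuallyEq (by
      filter_upwards [isOpen_Ioo.mem_nhds hx] with y hy
      exact hconst y (Set.Ioo_subset_Icc_self hy))
    have h2 := (hder x hx).unique h1
    exact Complex.normSq_eq_zero.1 ((mul_eq_zero.1 h2).resolve_left (hs x hx).ne')
  have := hz.of_subset_closure h.continuousOn_fst continuousOn_const Set.Ioo_subset_Icc_self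
    (closure_Ioo hl.ne).ge
  exact this

end IsEdgeSolution

/-- For a unitary matrix the coupling condition makes the total flux vanish. -/
lemma CouplingCondition.sum_im_eq_zero {N : ℕ}
    {U : Matrix (Fin N × Fin 2) (Fin N × Fin 2) ℂ}
    (hU : U ∈ Matrix.unitaryGroup (Fin N × Fin 2) ℂ) {x y : Fin N × Fin 2 → ℂ}
    (h : CouplingCondition U x y) : ∑ p, (star (x p) * y p).im = 0 := by
  -- The coupling condition is the Cayley form U(x + iy) = x - iy. Equality of the two norms is the
  -- vanishing of the flux, since |x - iy|² - |x + iy|² = 4 Im(x̄y) componentwise.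
  have h1 : U.mulVec (x + Complex.I • y) = x - Complex.I • y := by
    unfold CouplingCondition at h
    rw [Matrix.sub_mulVec, Matrix.add_mulVec, Matrix.one_mulVec, Matrix.one_mulVec] at h
    rw [Matrix.mulVec_add, Matrix.mulVec_smul]
    rw [smul_add] at h
    linear_combination h
  have h2 : star (x - Complex.I • y) ⬝ᵥ (x - Complex.I • y) =
      star (x + Complex.I • y) ⬝ᵥ (x + Complex.I • y) := by
    rw [← h1, Matrix.star_mulVec, Matrix.dotProduct_mulVec, Matrix.vecMul_vecMul,
      ← Matrix.star_eq_conjTranspose, Matrix.mem_unitaryGroup_iff'.1 hU, Matrix.vecMul_one]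
  have h3 : ∑ p, (((4 * (star (x p) * y p).im : ℝ)) : ℂ) = 0 := by
    rw [← sub_eq_zero.2 h2, dotProduct, dotProduct, ← Finset.sum_sub_distrib]
    refine Finset.sum_congr rfl fun p _ => ?_
    apply Complex.ext
    · simp; ring
    · simp; ring
  have h4 : ∑ p, 4 * (star (x p) * y p).im = 0 := by exact_mod_cast h3
  rw [← Finset.mul_sum] at h4
  linarith

lemma norm_coefficient_le {a b C : ℝ} (z : ℂ) (ha : |a| ≤ C) (hb : |b| ≤ C) :
    ‖z ^ 2 + 2 * z * a - b‖ ≤ ‖z‖ ^ 2 + 2 * ‖z‖ * C + C := by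
  refine (norm_sub_le _ _).trans (add_le_add ((norm_add_le _ _).trans (add_le_add ?_ ?_)) ?_)
  · simp
  · simp only [norm_mul, Complex.norm_real, Real.norm_eq_abs, Complex.norm_ofNat]
    gcongr
  · simpa using hb

lemma continuousOn_coefficient {l : ℝ} {a b : ℝ → ℝ} (ha : ContinuousOn a (Set.Ioo 0 l))
    (hb : ContinuousOn b (Set.Ioo 0 l)) (z : ℂ) :
    ContinuousOn (fun x => z ^ 2 + 2 * z * a x - b x) (Set.Ioo 0 l) :=
  (continuousOn_const.add (continuousOn_const.mul
    (Complex.continuous_ofReal.comp_continuousOn ha))).sub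
    (Complex.continuous_ofReal.comp_continuousOn hb)

/-- Non-real eigenvalues lie in the strip `|Re z| ≤ sup |a|`. -/
theorem abs_re_le_of_mem_graphEigenvalues {N : ℕ} {l : Fin N → ℝ} (hl : ∀ j, 0 < l j)
    {U : Matrix (Fin N × Fin 2) (Fin N × Fin 2) ℂ}
    (hU : U ∈ Matrix.unitaryGroup (Fin N × Fin 2) ℂ) {a b : Fin N → ℝ → ℝ} {C : ℝ}
    (ha : ∀ j, ContinuousOn (a j) (Set.Ioo 0 (l j)))
    (hb : ∀ j, ContinuousOn (b j) (Set.Ioo 0 (l j)))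
    (haC : ∀ j, ∀ x ∈ Set.Ioo 0 (l j), |a j x| ≤ C)
    (hbC : ∀ j, ∀ x ∈ Set.Ioo 0 (l j), |b j x| ≤ C)
    {z : ℂ} (hz : z ∈ graphEigenvalues l U a b) (him : z.im ≠ 0) : |z.re| ≤ C := by
  by_contra! hC
  obtain ⟨u, du, ddu, hsob, heq, hcoup, j, x, hx, hne⟩ := hz
  have hsol := fun j => (hsob j).isEdgeSolution (hl j).le (heq j)
  -- Since Im k = 2 Im z (Re z + a), for |Re z| > C the sign of Im k is that of Im z · Re z on all
  -- edges. The flux then increases along every edge in the same sense, while the total change is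
  -- zero by unitarity, so u vanishes.
  have hs : ∀ j, ∀ x ∈ Set.Ioo 0 (l j),
      0 < (z.im * z.re) * (z ^ 2 + 2 * z * (a j x : ℂ) - (b j x : ℂ)).im := by
    intro j x hx
    have e : (z ^ 2 + 2 * z * (a j x : ℂ) - (b j x : ℂ)).im = 2 * z.im * (z.re + a j x) := by
      simp [pow_two]; ring
    rw [e]
    have h1 : 0 < z.im ^ 2 := by positivity
    have h2 : 0 < z.re ^ 2 + z.re * a j x := by
      have h3 : |z.re * a j x| < z.re ^ 2 := by
        rw [abs_mul, ← sq_abs, pow_two]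
        have h4 := haC j x hx
        exact mul_lt_mul_of_pos_left (h4.trans_lt hC) (((abs_nonneg _).trans h4).trans_lt hC)
      linarith [neg_abs_le (z.re * a j x)]
    nlinarith [mul_pos h1 h2]
  have hflux := fun j => (hsol j).flux_le (hl j) (continuousOn_coefficient (ha j) (hb j) z)
    (fun x hx => norm_coefficient_le z (haC j x hx) (hbC j x hx)) (hs j)
  have hsum := hcoup.sum_im_eq_zero hU
  rw [Fintype.sum_prod_type] at hsum
  have hsum' : ∑ j, ((z.im * z.re) * (star (u j (l j)) * du j (l j)).im -
      (z.im * z.re) * (star (u j 0) * du j 0).im) = 0 := by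
    have : ∀ j, ((z.im * z.re) * (star (u j (l j)) * du j (l j)).im -
        (z.im * z.re) * (star (u j 0) * du j 0).im) = -(z.im * z.re) *
        ∑ e, (star (endValues l u (j, e)) * endDerivs l du (j, e)).im := fun j => by
      simp [endValues, endDerivs, Fin.sum_univ_two]
      ring
    simp only [this]
    rw [← Finset.mul_sum, hsum, mul_zero]
  have hzero := (Finset.sum_eq_zero_iff_of_nonneg fun j _ => sub_nonneg.2 (hflux j).1).1 hsum' j
    (Finset.mem_univ j)
  exact hne ((hflux j).2 (sub_eq_zero.1 hzero).le x hx)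

/-! ### Riemann–Lebesgue estimates and oscillating linear systems. -/

/-- Fundamental theorem of calculus for a bounded continuous derivative on the open interval. -/
lemma integral_eq_sub_of_mem_Icc {l : ℝ} {F F' : ℝ → ℂ} (hF : ContinuousOn F (Set.Icc 0 l))
    (hd : ∀ x ∈ Set.Ioo 0 l, HasDerivAt F (F' x) x) (hF' : ContinuousOn F' (Set.Ioo 0 l))
    {D : ℝ} (hD : ∀ x ∈ Set.Ioo 0 l, ‖F' x‖ ≤ D) {x : ℝ} (hx : x ∈ Set.Icc 0 l) :
    ∫ t in (0 : ℝ)..x, F' t = F x - F 0 :=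
  intervalIntegral.integral_eq_sub_of_hasDerivAt_of_le hx.1
    (hF.mono (Set.Icc_subset_Icc_right hx.2))
    (fun y hy => hd y ⟨hy.1, hy.2.trans_le hx.2⟩)
    ((intervalIntegrable_of_bounded_continuousOn (hx.1.trans hx.2) hF' hD).mono_Icc hx)

lemma norm_integral_le_of_mem_Icc {l : ℝ} {g : ℝ → ℂ} {D : ℝ}
    (hD : ∀ x ∈ Set.Ioo 0 l, ‖g x‖ ≤ D) (hD0 : 0 ≤ D) {x : ℝ} (hx : x ∈ Set.Icc 0 l) :
    ‖∫ t in (0 : ℝ)..x, g t‖ ≤ D * l := by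
  have h : ‖∫ t in (0 : ℝ)..x, g t‖ ≤ ∫ t in (0 : ℝ)..x, D := by
    refine intervalIntegral.norm_integral_le_of_norm_le hx.1 ?_ (by simp)
    filter_upwards [Measure.ae_ne volume l] with t ht htx
    exact hD t ⟨htx.1, lt_of_le_of_ne (htx.2.trans hx.2) ht⟩
  rw [intervalIntegral.integral_const, smul_eq_mul, sub_zero, mul_comm] at h
  exact h.trans (mul_le_mul_of_nonneg_left hx.2 hD0)

lemma norm_sub_le_of_deriv_bound {l : ℝ} {F F' : ℝ → ℂ} (hF : ContinuousOn F (Set.Icc 0 l))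
    (hd : ∀ x ∈ Set.Ioo 0 l, HasDerivAt F (F' x) x) (hF' : ContinuousOn F' (Set.Ioo 0 l))
    {D : ℝ} (hD0 : 0 ≤ D) (hD : ∀ x ∈ Set.Ioo 0 l, ‖F' x‖ ≤ D) {x : ℝ} (hx : x ∈ Set.Icc 0 l) :
    ‖F x - F 0‖ ≤ D * l := by
  rw [← integral_eq_sub_of_mem_Icc hF hd hF' hD hx]
  exact norm_integral_le_of_mem_Icc hD hD0 hx

/-- A bounded continuous function on `(0, l)` is approximated in mean by polynomials. -/
lemma exists_polynomial_integral_near {l : ℝ} (hl : 0 < l) {a : ℝ → ℝ} {C : ℝ}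
    (ha : ContinuousOn a (Set.Ioo 0 l)) (haC : ∀ x ∈ Set.Ioo 0 l, |a x| ≤ C)
    {ε : ℝ} (hε : 0 < ε) :
    ∃ p : Polynomial ℝ, ∫ t in (0 : ℝ)..l, |a t - p.eval t| ≤ ε := by
  have hai : IntegrableOn a (Set.Ioo 0 l) := integrableOn_of_bounded_continuousOn ha haC
  obtain ⟨g, -, hg, hgc, hgi⟩ := ((integrable_indicator_iff measurableSet_Ioo).2
    hai).exists_hasCompactSupport_integral_sub_le (half_pos hε)
  obtain ⟨p, hp⟩ := exists_polynomial_near_of_continuousOn 0 l g hgc.continuousOn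
    (ε / (2 * l)) (by positivity)
  refine ⟨p, ?_⟩
  have hI : IntervalIntegrable a volume 0 l :=
    (intervalIntegrable_iff_integrableOn_Ioo_of_le hl.le).2 hai
  have hG : IntervalIntegrable g volume 0 l := hgc.intervalIntegrable _ _
  have hP : IntervalIntegrable (fun t => p.eval t) volume 0 l :=
    p.continuous.intervalIntegrable _ _
  have h1 : ∫ t in (0 : ℝ)..l, |a t - g t| ≤ ε / 2 := by
    refine le_trans ?_ hg
    rw [intervalIntegral.integral_of_le hl.le, integral_Ioc_eq_integral_Ioo]
    calc ∫ t in Set.Ioo 0 l, |a t - g t|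
        = ∫ t in Set.Ioo 0 l, ‖(Set.Ioo 0 l).indicator a t - g t‖ := by
          refine setIntegral_congr_fun measurableSet_Ioo fun t ht => ?_
          simp only [Set.indicator_of_mem ht, Real.norm_eq_abs]
      _ ≤ _ := setIntegral_le_integral
          ((((integrable_indicator_iff measurableSet_Ioo).2 hai).sub hgi).norm)
          (Eventually.of_forall fun t => norm_nonneg _)
  have h2 : ∫ t in (0 : ℝ)..l, |g t - p.eval t| ≤ ε / 2 := by
    calc ∫ t in (0 : ℝ)..l, |g t - p.eval t| ≤ ∫ t in (0 : ℝ)..l, ε / (2 * l) := by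
          refine intervalIntegral.integral_mono_on hl.le (hG.sub hP).abs (by simp) fun t ht => ?_
          rw [abs_sub_comm]
          exact (hp t ht).le
      _ = ε / 2 := by
          rw [intervalIntegral.integral_const, smul_eq_mul]
          field_simp
          ring
  calc ∫ t in (0 : ℝ)..l, |a t - p.eval t|
      ≤ ∫ t in (0 : ℝ)..l, (|a t - g t| + |g t - p.eval t|) :=
        intervalIntegral.integral_mono_on hl.le (hI.sub hP).abs
          ((hI.sub hG).abs.add (hG.sub hP).abs) fun t _ => abs_sub_le _ _ _
    _ ≤ ε := by
        rw [intervalIntegral.integral_add (hI.sub hG).abs (hG.sub hP).abs]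
        linarith

/-- Riemann–Lebesgue: a bounded function with small primitive has small integrals against `a`,
uniformly over the interval of integration. -/
lemma exists_bound_integral_mul {l : ℝ} (hl : 0 < l) {a : ℝ → ℝ} {C : ℝ}
    (ha : ContinuousOn a (Set.Ioo 0 l)) (haC : ∀ x ∈ Set.Ioo 0 l, |a x| ≤ C)
    {ε M : ℝ} (hε : 0 < ε) (hM : 0 < M) :
    ∃ K : ℝ, 0 ≤ K ∧ ∀ (E : ℝ → ℂ) (δ : ℝ), ContinuousOn E (Set.Icc 0 l) →
      (∀ x ∈ Set.Icc 0 l, ‖E x‖ ≤ M) →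
      (∀ x ∈ Set.Icc 0 l, ‖∫ t in (0 : ℝ)..x, E t‖ ≤ δ) →
      ∀ x ∈ Set.Icc 0 l, ‖∫ t in (0 : ℝ)..x, (a t : ℂ) * E t‖ ≤ ε + K * δ := by
  -- The L¹ error ε/M costs at most ε against any E bounded by M. The polynomial part is integrated
  -- by parts, so K depends only on p and l: this gives uniformity over E, whose phase will depend
  -- on z and on a itself.
  obtain ⟨p, hp⟩ := exists_polynomial_integral_near hl ha haC (div_pos hε hM)
  obtain ⟨K₀, hK₀⟩ := isCompact_Icc.exists_bound_of_continuousOn (s := Set.Icc 0 l)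
    p.continuous.continuousOn
  obtain ⟨K₁, hK₁⟩ := isCompact_Icc.exists_bound_of_continuousOn (s := Set.Icc 0 l)
    p.derivative.continuous.continuousOn
  have h0 : (0 : ℝ) ∈ Set.Icc 0 l := Set.left_mem_Icc.2 hl.le
  have hK₀0 : 0 ≤ K₀ := (norm_nonneg _).trans (hK₀ 0 h0)
  have hK₁0 : 0 ≤ K₁ := (norm_nonneg _).trans (hK₁ 0 h0)
  refine ⟨K₀ + K₁ * l, by positivity, fun E δ hE hEM hEδ x hx => ?_⟩
  have hδ0 : 0 ≤ δ := (norm_nonneg _).trans (hEδ 0 h0)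
  have hEi : IntervalIntegrable E volume 0 l := hE.intervalIntegrable_of_Icc hl.le
  have hai : IntervalIntegrable a volume 0 l :=
    intervalIntegrable_of_bounded_continuousOn hl.le ha haC
  set J : ℝ → ℂ := fun y => ∫ t in (0 : ℝ)..y, E t with hJ
  have hJc : ContinuousOn J (Set.Icc 0 l) := continuousOn_primitive_Icc hl.le hEi
  have hJd : ∀ y ∈ Set.Ioo 0 l, HasDerivAt J (E y) y := fun y hy =>
    hasDerivAt_primitive_of_mem_Ioo (hE.mono Set.Ioo_subset_Icc_self) hEi hy
  have hpc : Continuous fun y : ℝ => ((p.eval y : ℝ) : ℂ) := by fun_prop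
  have hpc' : Continuous fun y : ℝ => ((p.derivative.eval y : ℝ) : ℂ) := by fun_prop
  have hpE : ‖∫ t in (0 : ℝ)..x, ((p.eval t : ℝ) : ℂ) * E t‖ ≤ (K₀ + K₁ * l) * δ := by
    have hI1 : IntervalIntegrable (fun t => ((p.eval t : ℝ) : ℂ) * E t) volume 0 x :=
      (hEi.continuousOn_mul hpc.continuousOn).mono_Icc hx
    have hI2 : IntervalIntegrable (fun t => ((p.derivative.eval t : ℝ) : ℂ) * J t) volume 0 x :=
      ((hJc.intervalIntegrable_of_Icc hl.le).continuousOn_mul hpc'.continuousOn).mono_Icc hx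
    have hparts : ∫ t in (0 : ℝ)..x, (((p.derivative.eval t : ℝ) : ℂ) * J t +
        ((p.eval t : ℝ) : ℂ) * E t) = ((p.eval x : ℝ) : ℂ) * J x - ((p.eval 0 : ℝ) : ℂ) * J 0 := by
      refine intervalIntegral.integral_eq_sub_of_hasDerivAt_of_le hx.1
        (hpc.continuousOn.mul (hJc.mono (Set.Icc_subset_Icc_right hx.2))) (fun y hy => ?_)
        (hI2.add hI1)
      exact ((p.hasDerivAt y).ofReal_comp).mul (hJd y ⟨hy.1, hy.2.trans_le hx.2⟩)
    rw [intervalIntegral.integral_add hI2 hI1] at hparts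
    have hJ0 : J 0 = 0 := intervalIntegral.integral_same
    rw [hJ0, mul_zero, sub_zero] at hparts
    rw [eq_sub_of_add_eq' hparts]
    have e1 : ‖((p.eval x : ℝ) : ℂ) * J x‖ ≤ K₀ * δ := by
      rw [norm_mul, Complex.norm_real]
      exact mul_le_mul (hK₀ x hx) (hEδ x hx) (norm_nonneg _) hK₀0
    have e2 : ‖∫ t in (0 : ℝ)..x, ((p.derivative.eval t : ℝ) : ℂ) * J t‖ ≤ K₁ * δ * l := by
      refine norm_integral_le_of_mem_Icc (fun t ht => ?_) (by positivity) hx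
      rw [norm_mul, Complex.norm_real]
      have ht' := Set.Ioo_subset_Icc_self ht
      exact mul_le_mul (hK₁ t ht') (hEδ t ht') (norm_nonneg _) hK₁0
    calc _ ≤ _ := norm_sub_le _ _
      _ ≤ K₀ * δ + K₁ * δ * l := add_le_add e1 e2
      _ = _ := by ring
  have hrest : ‖∫ t in (0 : ℝ)..x, ((a t - p.eval t : ℝ) : ℂ) * E t‖ ≤ ε := by
    have hd : IntervalIntegrable (fun t => |a t - p.eval t| * M) volume 0 l :=
      (hai.sub (p.continuous.intervalIntegrable _ _)).abs.mul_const M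
    calc ‖∫ t in (0 : ℝ)..x, ((a t - p.eval t : ℝ) : ℂ) * E t‖
        ≤ ∫ t in (0 : ℝ)..x, |a t - p.eval t| * M := by
          refine intervalIntegral.norm_integral_le_of_norm_le hx.1
            (Eventually.of_forall fun t ht => ?_) (hd.mono_Icc hx)
          rw [norm_mul, Complex.norm_real, Real.norm_eq_abs]
          gcongr
          exact hEM t ⟨ht.1.le, ht.2.trans hx.2⟩
      _ ≤ ∫ t in (0 : ℝ)..l, |a t - p.eval t| * M :=
          intervalIntegral.integral_mono_interval le_rfl hx.1 hx.2
            (Eventually.of_forall fun t => by positivity) hd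
      _ = (∫ t in (0 : ℝ)..l, |a t - p.eval t|) * M := intervalIntegral.integral_mul_const _ _
      _ ≤ ε / M * M := by gcongr
      _ = ε := div_mul_cancel₀ _ hM.ne'
  have hsplit : ∫ t in (0 : ℝ)..x, (a t : ℂ) * E t =
      (∫ t in (0 : ℝ)..x, ((a t - p.eval t : ℝ) : ℂ) * E t) +
        ∫ t in (0 : ℝ)..x, ((p.eval t : ℝ) : ℂ) * E t := by
    rw [← intervalIntegral.integral_add]
    · refine intervalIntegral.integral_congr fun t _ => ?_
      push_cast
      ring
    · have : IntervalIntegrable (fun t => ((a t - p.eval t : ℝ) : ℂ)) volume 0 l := by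
        have := hai.sub (p.continuous.intervalIntegrable (μ := volume) 0 l)
        exact ⟨this.1.ofReal, this.2.ofReal⟩
      refine (this.mul_continuousOn ?_).mono_Icc hx
      rwa [Set.uIcc_of_le hl.le]
    · exact (hEi.continuousOn_mul hpc.continuousOn).mono_Icc hx
  rw [hsplit]
  exact (norm_add_le _ _).trans (add_le_add hrest hpE)

/-- With G = ∫₀ˣ g, integration by parts trades the large coefficient g for its small primitive: P -
GQ has derivative -GhP, where every term carries a factor ε. -/
lemma norm_sub_le_of_offdiagonal {l : ℝ} (hl : 0 < l) {P Q g h : ℝ → ℂ} {D ε S : ℝ}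
    (hP : ContinuousOn P (Set.Icc 0 l)) (hQ : ContinuousOn Q (Set.Icc 0 l))
    (hg : ContinuousOn g (Set.Ioo 0 l)) (hh : ContinuousOn h (Set.Ioo 0 l))
    (hP' : ∀ x ∈ Set.Ioo 0 l, HasDerivAt P (g x * Q x) x)
    (hQ' : ∀ x ∈ Set.Ioo 0 l, HasDerivAt Q (h x * P x) x)
    (hgD : ∀ x ∈ Set.Ioo 0 l, ‖g x‖ ≤ D) (hhD : ∀ x ∈ Set.Ioo 0 l, ‖h x‖ ≤ D)
    (hgε : ∀ x ∈ Set.Icc 0 l, ‖∫ t in (0 : ℝ)..x, g t‖ ≤ ε)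
    (hPS : ∀ x ∈ Set.Icc 0 l, ‖P x‖ ≤ S) (hQS : ∀ x ∈ Set.Icc 0 l, ‖Q x‖ ≤ S)
    (hD0 : 0 ≤ D) {x : ℝ} (hx : x ∈ Set.Icc 0 l) :
    ‖P x - P 0‖ ≤ ε * (1 + D * l) * S := by
  have h0 : (0 : ℝ) ∈ Set.Icc 0 l := Set.left_mem_Icc.2 hl.le
  have hε0 : 0 ≤ ε := (norm_nonneg _).trans (hgε 0 h0)
  have hS0 : 0 ≤ S := (norm_nonneg _).trans (hPS 0 h0)
  have hgi : IntervalIntegrable g volume 0 l :=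
    intervalIntegrable_of_bounded_continuousOn hl.le hg hgD
  set G : ℝ → ℂ := fun y => ∫ t in (0 : ℝ)..y, g t with hG
  have hGc : ContinuousOn G (Set.Icc 0 l) := continuousOn_primitive_Icc hl.le hgi
  have hsub := Set.Ioo_subset_Icc_self (a := (0 : ℝ)) (b := l)
  have key := norm_sub_le_of_deriv_bound (F := fun y => P y - G y * Q y)
    (F' := fun y => -(G y * (h y * P y))) (D := ε * (D * S)) (hP.sub (hGc.mul hQ))
    (fun y hy => by
      refine ((hP' y hy).sub ((hasDerivAt_primitive_of_mem_Ioo hg hgi hy).mul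
        (hQ' y hy))).congr_deriv ?_
      ring)
    (((hGc.mono hsub).mul (hh.mul (hP.mono hsub))).neg) (by positivity)
    (fun y hy => by
      rw [norm_neg, norm_mul, norm_mul]
      exact mul_le_mul (hgε y (hsub hy)) (mul_le_mul (hhD y hy) (hPS y (hsub hy))
        (norm_nonneg _) hD0) (by positivity) hε0) hx
  have hG0 : G 0 = 0 := intervalIntegral.integral_same
  simp only [hG0, zero_mul, sub_zero] at key
  have e1 : ‖G x * Q x‖ ≤ ε * S := by
    rw [norm_mul]
    exact mul_le_mul (hgε x hx) (hQS x hx) (norm_nonneg _) hε0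
  calc ‖P x - P 0‖ = ‖(P x - G x * Q x - P 0) + G x * Q x‖ := by congr 1; ring
    _ ≤ _ := norm_add_le _ _
    _ ≤ ε * (D * S) * l + ε * S := add_le_add key e1
    _ = _ := by ring

/-- A linear system with oscillating off-diagonal coefficients is nearly constant. -/
lemma norm_sub_le_of_oscillating {l : ℝ} (hl : 0 < l) {P Q g h : ℝ → ℂ} {D ε : ℝ}
    (hP : ContinuousOn P (Set.Icc 0 l)) (hQ : ContinuousOn Q (Set.Icc 0 l))
    (hg : ContinuousOn g (Set.Ioo 0 l)) (hh : ContinuousOn h (Set.Ioo 0 l))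
    (hP' : ∀ x ∈ Set.Ioo 0 l, HasDerivAt P (g x * Q x) x)
    (hQ' : ∀ x ∈ Set.Ioo 0 l, HasDerivAt Q (h x * P x) x)
    (hgD : ∀ x ∈ Set.Ioo 0 l, ‖g x‖ ≤ D) (hhD : ∀ x ∈ Set.Ioo 0 l, ‖h x‖ ≤ D)
    (hgε : ∀ x ∈ Set.Icc 0 l, ‖∫ t in (0 : ℝ)..x, g t‖ ≤ ε)
    (hhε : ∀ x ∈ Set.Icc 0 l, ‖∫ t in (0 : ℝ)..x, h t‖ ≤ ε)
    (hD0 : 0 ≤ D) (hsmall : ε * (1 + D * l) ≤ 1 / 2) {x : ℝ} (hx : x ∈ Set.Icc 0 l) :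
    ‖P x - P 0‖ ≤ 2 * (ε * (1 + D * l)) * (‖P 0‖ + ‖Q 0‖) ∧
      ‖Q x - Q 0‖ ≤ 2 * (ε * (1 + D * l)) * (‖P 0‖ + ‖Q 0‖) := by
  have h0 : (0 : ℝ) ∈ Set.Icc 0 l := Set.left_mem_Icc.2 hl.le
  have hε0 : 0 ≤ ε := (norm_nonneg _).trans (hgε 0 h0)
  have hmc : ContinuousOn (fun y => max ‖P y‖ ‖Q y‖) (Set.Icc 0 l) :=
    continuous_max.comp_continuousOn (hP.norm.prodMk hQ.norm)
  obtain ⟨y, hy, hmax⟩ := isCompact_Icc.exists_isMaxOn ⟨0, h0⟩ hmc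
  set S := max ‖P y‖ ‖Q y‖ with hS
  have hPS : ∀ x ∈ Set.Icc 0 l, ‖P x‖ ≤ S := fun x hx => (le_max_left _ _).trans (hmax hx)
  have hQS : ∀ x ∈ Set.Icc 0 l, ‖Q x‖ ≤ S := fun x hx => (le_max_right _ _).trans (hmax hx)
  have hS0 : 0 ≤ S := (norm_nonneg _).trans (hPS 0 h0)
  have h1 := fun x (hx : x ∈ Set.Icc 0 l) =>
    norm_sub_le_of_offdiagonal hl hP hQ hg hh hP' hQ' hgD hhD hgε hPS hQS hD0 hx
  have h2 := fun x (hx : x ∈ Set.Icc 0 l) =>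
    norm_sub_le_of_offdiagonal hl hQ hP hh hg hQ' hP' hhD hgD hhε hQS hPS hD0 hx
  -- The deviations are at most S/2 by the smallness of ε, so the maximum S can be absorbed and is
  -- controlled by the initial values.
  have h3 : S ≤ 2 * (‖P 0‖ + ‖Q 0‖) := by
    have e1 : ‖P y‖ ≤ ‖P 0‖ + 1 / 2 * S := by
      have := norm_le_norm_add_norm_sub' (P y) (P 0)
      nlinarith [h1 y hy]
    have e2 : ‖Q y‖ ≤ ‖Q 0‖ + 1 / 2 * S := by
      have := norm_le_norm_add_norm_sub' (Q y) (Q 0)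
      nlinarith [h2 y hy]
    have e3 : S ≤ ‖P 0‖ + ‖Q 0‖ + 1 / 2 * S := max_le
      (by linarith [norm_nonneg (Q 0)]) (by linarith [norm_nonneg (P 0)])
    linarith
  have h4 : ε * (1 + D * l) * S ≤ 2 * (ε * (1 + D * l)) * (‖P 0‖ + ‖Q 0‖) := by
    have : 0 ≤ ε * (1 + D * l) := by positivity
    nlinarith [mul_le_mul_of_nonneg_left h3 this]
  exact ⟨(h1 x hx).trans h4, (h2 x hx).trans h4⟩

/-! ### Waves on a single edge at high frequency. -/

/-- The effective damping `a - b / (2z)` of an edge. -/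
noncomputable def edgeDamping (a b : ℝ → ℝ) (z : ℂ) (x : ℝ) : ℂ := a x - b x / (2 * z)

/-- The complex phase `zx + ∫₀ˣ (a - b / (2z))` of the waves on an edge. -/
noncomputable def edgePhase (a b : ℝ → ℝ) (z : ℂ) (x : ℝ) : ℂ :=
  z * x + ∫ t in (0 : ℝ)..x, edgeDamping a b z t

section

variable {l : ℝ} {a b : ℝ → ℝ} {C : ℝ}

lemma continuousOn_edgeDamping (ha : ContinuousOn a (Set.Ioo 0 l))
    (hb : ContinuousOn b (Set.Ioo 0 l)) (z : ℂ) :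
    ContinuousOn (edgeDamping a b z) (Set.Ioo 0 l) :=
  (Complex.continuous_ofReal.comp_continuousOn ha).sub
    ((Complex.continuous_ofReal.comp_continuousOn hb).div_const _)

lemma norm_edgeDamping_le (haC : ∀ x ∈ Set.Ioo 0 l, |a x| ≤ C)
    (hbC : ∀ x ∈ Set.Ioo 0 l, |b x| ≤ C) {z : ℂ} (hz : 1 ≤ ‖z‖) :
    ∀ x ∈ Set.Ioo 0 l, ‖edgeDamping a b z x‖ ≤ 2 * C := by
  intro x hx
  have h1 := haC x hx
  have h2 := hbC x hx
  have h3 : ‖(b x : ℂ) / (2 * z)‖ ≤ C := by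
    rw [norm_div, Complex.norm_real, Real.norm_eq_abs, norm_mul, Complex.norm_ofNat]
    exact (div_le_self (abs_nonneg _) (by linarith)).trans h2
  refine (norm_sub_le _ _).trans ?_
  rw [Complex.norm_real, Real.norm_eq_abs]
  linarith

lemma edgePhase_zero (a b : ℝ → ℝ) (z : ℂ) : edgePhase a b z 0 = 0 := by simp [edgePhase]

lemma continuousOn_edgePhase (hl : 0 ≤ l) (ha : ContinuousOn a (Set.Ioo 0 l))
    (hb : ContinuousOn b (Set.Ioo 0 l)) (haC : ∀ x ∈ Set.Ioo 0 l, |a x| ≤ C)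
    (hbC : ∀ x ∈ Set.Ioo 0 l, |b x| ≤ C) {z : ℂ} (hz : 1 ≤ ‖z‖) :
    ContinuousOn (edgePhase a b z) (Set.Icc 0 l) :=
  (by fun_prop : Continuous fun x : ℝ => z * (x : ℂ)).continuousOn.add
    (continuousOn_primitive_Icc hl (intervalIntegrable_of_bounded_continuousOn hl
      (continuousOn_edgeDamping ha hb z) (norm_edgeDamping_le haC hbC hz)))

lemma hasDerivAt_edgePhase (ha : ContinuousOn a (Set.Ioo 0 l))
    (hb : ContinuousOn b (Set.Ioo 0 l)) (haC : ∀ x ∈ Set.Ioo 0 l, |a x| ≤ C)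
    (hbC : ∀ x ∈ Set.Ioo 0 l, |b x| ≤ C) {z : ℂ} (hz : 1 ≤ ‖z‖) {x : ℝ}
    (hx : x ∈ Set.Ioo 0 l) :
    HasDerivAt (edgePhase a b z) (z + edgeDamping a b z x) x := by
  have h1 : HasDerivAt (fun x : ℝ => z * (x : ℂ)) z x := by
    simpa using (hasDerivAt_id x).ofReal_comp.const_mul z
  exact h1.add (hasDerivAt_primitive_of_mem_Ioo (continuousOn_edgeDamping ha hb z)
    (intervalIntegrable_of_bounded_continuousOn (hx.1.le.trans hx.2.le)
      (continuousOn_edgeDamping ha hb z) (norm_edgeDamping_le haC hbC hz)) hx)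

lemma abs_re_edgePhase_le (hC0 : 0 ≤ C) (haC : ∀ x ∈ Set.Ioo 0 l, |a x| ≤ C)
    (hbC : ∀ x ∈ Set.Ioo 0 l, |b x| ≤ C) {z : ℂ} (hz : 1 ≤ ‖z‖) {R : ℝ} (hR : |z.re| ≤ R)
    {x : ℝ} (hx : x ∈ Set.Icc 0 l) : |(edgePhase a b z x).re| ≤ R * l + 2 * C * l := by
  rw [edgePhase, Complex.add_re, Complex.re_mul_ofReal]
  refine (abs_add_le _ _).trans (add_le_add ?_ ?_)
  · rw [abs_mul, abs_of_nonneg hx.1]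
    exact mul_le_mul hR hx.2 hx.1 ((abs_nonneg _).trans hR)
  · exact (Complex.abs_re_le_norm _).trans (norm_integral_le_of_mem_Icc
      (norm_edgeDamping_le haC hbC hz) (by positivity) hx)

lemma norm_exp_edgePhase_le (hC0 : 0 ≤ C) (haC : ∀ x ∈ Set.Ioo 0 l, |a x| ≤ C)
    (hbC : ∀ x ∈ Set.Ioo 0 l, |b x| ≤ C) {z : ℂ} (hz : 1 ≤ ‖z‖) {R : ℝ} (hR : |z.re| ≤ R)
    {s : ℝ} (hs : |s| = 1) {x : ℝ} (hx : x ∈ Set.Icc 0 l) :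
    ‖Complex.exp (2 * s * edgePhase a b z x)‖ ≤ Real.exp (2 * (R * l + 2 * C * l)) := by
  rw [Complex.norm_exp]
  refine Real.exp_le_exp.2 ?_
  have e : (2 * (s : ℂ) * edgePhase a b z x).re = 2 * (s * (edgePhase a b z x).re) := by
    simp [mul_assoc]
  rw [e]
  have h1 : |s * (edgePhase a b z x).re| ≤ R * l + 2 * C * l := by
    rw [abs_mul, hs, one_mul]
    exact abs_re_edgePhase_le hC0 haC hbC hz hR hx
  linarith [le_abs_self (s * (edgePhase a b z x).re)]

/-- The oscillating integrals `∫₀ˣ (a - b/(2z)) e^{±2θ}` tend to zero at high frequency. -/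
lemma eventually_norm_integral_damping_exp_le (hl : 0 < l) (hC0 : 0 ≤ C)
    (ha : ContinuousOn a (Set.Ioo 0 l)) (hb : ContinuousOn b (Set.Ioo 0 l))
    (haC : ∀ x ∈ Set.Ioo 0 l, |a x| ≤ C) (hbC : ∀ x ∈ Set.Ioo 0 l, |b x| ≤ C)
    (R : ℝ) {s : ℝ} (hs : |s| = 1) {ε : ℝ} (hε : 0 < ε) :
    ∀ᶠ z in highFrequencyFilter R, ∀ x ∈ Set.Icc 0 l,
      ‖∫ t in (0 : ℝ)..x, edgeDamping a b z t * Complex.exp (2 * s * edgePhase a b z t)‖ ≤ ε := by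
  set M := Real.exp (2 * (R * l + 2 * C * l)) with hM
  have hM0 : 0 < M := Real.exp_pos _
  obtain ⟨K, hK0, hK⟩ := exists_bound_integral_mul hl ha haC (half_pos hε) hM0
  set B := M + 1 + 4 * C * M * l with hB
  have hB0 : 0 ≤ B := by positivity
  have hlim : Tendsto (fun z : ℂ => (K * B + C * M * l) / ‖z‖) (highFrequencyFilter R) (𝓝 0) :=
    (tendsto_norm_highFrequencyFilter R).const_div_atTop _
  have hre : ∀ᶠ z in highFrequencyFilter R, |z.re| ≤ R :=
    eventually_highFrequencyFilter.2 ⟨0, fun z h _ => h⟩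
  filter_upwards [(tendsto_norm_highFrequencyFilter R).eventually_ge_atTop 1, hre,
    hlim.eventually (gt_mem_nhds (half_pos hε))] with z hz hzR hsmall x hx
  have hz0 : 0 < ‖z‖ := by linarith
  have hzne : z ≠ 0 := norm_pos_iff.1 hz0
  have hs0 : (s : ℂ) ≠ 0 := by
    intro h
    have : s = 0 := by exact_mod_cast h
    rw [this, abs_zero] at hs
    norm_num at hs
  set E : ℝ → ℂ := fun t => Complex.exp (2 * s * edgePhase a b z t) with hE
  have hθ := continuousOn_edgePhase hl.le ha hb haC hbC hz
  have hEc : ContinuousOn E (Set.Icc 0 l) :=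
    Complex.continuous_exp.comp_continuousOn (continuousOn_const.mul hθ)
  have hEM : ∀ x ∈ Set.Icc 0 l, ‖E x‖ ≤ M := fun x hx =>
    norm_exp_edgePhase_le hC0 haC hbC hz hzR hs hx
  have hsub := Set.Ioo_subset_Icc_self (a := (0 : ℝ)) (b := l)
  have hα := continuousOn_edgeDamping ha hb z
  have hαC := norm_edgeDamping_le haC hbC hz
  have hEi : IntervalIntegrable E volume 0 l := hEc.intervalIntegrable_of_Icc hl.le
  have hαE : ContinuousOn (fun t => edgeDamping a b z t * E t) (Set.Ioo 0 l) :=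
    hα.mul (hEc.mono hsub)
  have hαEM : ∀ t ∈ Set.Ioo 0 l, ‖edgeDamping a b z t * E t‖ ≤ 2 * C * M := fun t ht => by
    rw [norm_mul]
    exact mul_le_mul (hαC t ht) (hEM t (hsub ht)) (norm_nonneg _) (by positivity)
  have hαEi : IntervalIntegrable (fun t => edgeDamping a b z t * E t) volume 0 l :=
    intervalIntegrable_of_bounded_continuousOn hl.le hαE hαEM
  -- Integrating E' = 2s(z + α)E, with α the effective damping, gives 2sz∫E = E(x) - 1 - 2s∫αE. The
  -- right side is bounded by B, so the primitive of E is O(1/|z|).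
  have hprim : ∀ x ∈ Set.Icc 0 l, ‖∫ t in (0 : ℝ)..x, E t‖ ≤ B / ‖z‖ := by
    intro x hx
    have hftc := intervalIntegral.integral_eq_sub_of_hasDerivAt_of_le (f := E)
      (f' := fun t => 2 * s * z * E t + 2 * s * (edgeDamping a b z t * E t)) hx.1
      (hEc.mono (Set.Icc_subset_Icc_right hx.2)) (fun y hy => by
        have := ((hasDerivAt_edgePhase ha hb haC hbC hz
          ⟨hy.1, hy.2.trans_le hx.2⟩).const_mul (2 * (s : ℂ))).cexp
        refine this.congr_deriv ?_
        simp only [hE]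
        ring) (((hEi.const_mul _).add (hαEi.const_mul _)).mono_Icc hx)
    rw [intervalIntegral.integral_add ((hEi.const_mul _).mono_Icc hx)
      ((hαEi.const_mul _).mono_Icc hx), intervalIntegral.integral_const_mul,
      intervalIntegral.integral_const_mul] at hftc
    have hE0 : E 0 = 1 := by simp [hE, edgePhase_zero]
    rw [hE0] at hftc
    have h1 : ‖2 * s * z * ∫ t in (0 : ℝ)..x, E t‖ ≤ B := by
      rw [eq_sub_of_add_eq hftc]
      refine (norm_sub_le _ _).trans ?_
      have e1 : ‖E x - 1‖ ≤ M + 1 := (norm_sub_le _ _).trans (by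
        rw [norm_one]; linarith [hEM x hx])
      have e2 : ‖2 * (s : ℂ) * ∫ t in (0 : ℝ)..x, edgeDamping a b z t * E t‖ ≤
          2 * (2 * C * M * l) := by
        rw [norm_mul, norm_mul, Complex.norm_ofNat, Complex.norm_real, Real.norm_eq_abs, hs,
          mul_one]
        exact mul_le_mul_of_nonneg_left
          (norm_integral_le_of_mem_Icc hαEM (by positivity) hx) zero_le_two
      rw [hB]
      linarith
    rw [norm_mul, norm_mul, norm_mul, Complex.norm_ofNat, Complex.norm_real, Real.norm_eq_abs, hs,
      mul_one] at h1
    rw [le_div_iff₀ hz0]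
    nlinarith [mul_nonneg hz0.le (norm_nonneg (∫ t in (0 : ℝ)..x, E t))]
  have hI := hK E (B / ‖z‖) hEc hEM hprim x hx
  have hbE : ∀ t ∈ Set.Ioo 0 l, ‖(b t : ℂ) / (2 * z) * E t‖ ≤ C * M / ‖z‖ := fun t ht => by
    rw [norm_mul, norm_div, norm_mul, Complex.norm_real, Real.norm_eq_abs, Complex.norm_ofNat]
    calc |b t| / (2 * ‖z‖) * ‖E t‖ ≤ C / ‖z‖ * M := by
          gcongr
          · exact hbC t ht
          · linarith
          · exact hEM t (hsub ht)
      _ = _ := by ring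
  have hbEi : IntervalIntegrable (fun t => (b t : ℂ) / (2 * z) * E t) volume 0 l :=
    intervalIntegrable_of_bounded_continuousOn hl.le
      (((Complex.continuous_ofReal.comp_continuousOn hb).div_const _).mul (hEc.mono hsub)) hbE
  have haEi : IntervalIntegrable (fun t => (a t : ℂ) * E t) volume 0 l :=
    intervalIntegrable_of_bounded_continuousOn hl.le (C := C * M)
      ((Complex.continuous_ofReal.comp_continuousOn ha).mul (hEc.mono hsub)) fun t ht => by
        rw [norm_mul, Complex.norm_real, Real.norm_eq_abs]
        exact mul_le_mul (haC t ht) (hEM t (hsub ht)) (norm_nonneg _) hC0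
  have hsplit : ∫ t in (0 : ℝ)..x, edgeDamping a b z t * E t =
      (∫ t in (0 : ℝ)..x, (a t : ℂ) * E t) - ∫ t in (0 : ℝ)..x, (b t : ℂ) / (2 * z) * E t := by
    rw [← intervalIntegral.integral_sub (haEi.mono_Icc hx) (hbEi.mono_Icc hx)]
    refine intervalIntegral.integral_congr fun t _ => ?_
    simp only [edgeDamping]
    ring
  rw [hsplit]
  refine (norm_sub_le _ _).trans ?_
  have h2 := norm_integral_le_of_mem_Icc hbE (by positivity) hx
  have e : (K * B + C * M * l) / ‖z‖ = K * (B / ‖z‖) + C * M / ‖z‖ * l := by ring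
  rw [e] at hsmall
  linarith

/-- The amplitudes of the two waves on an edge are nearly constant at high frequency. -/
theorem eventually_edge_amplitudes (hl : 0 < l) (hC0 : 0 ≤ C)
    (ha : ContinuousOn a (Set.Ioo 0 l)) (hb : ContinuousOn b (Set.Ioo 0 l))
    (haC : ∀ x ∈ Set.Ioo 0 l, |a x| ≤ C) (hbC : ∀ x ∈ Set.Ioo 0 l, |b x| ≤ C)
    (R : ℝ) {ε : ℝ} (hε : 0 < ε) :
    ∀ᶠ z in highFrequencyFilter R, ∀ u du,
      IsEdgeSolution l (fun x => z ^ 2 + 2 * z * a x - b x) u du →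
      ‖Complex.exp (-edgePhase a b z l) * ((u l + du l / z) / 2) - (u 0 + du 0 / z) / 2‖ ≤
          ε * (‖(u 0 + du 0 / z) / 2‖ + ‖(u 0 - du 0 / z) / 2‖) ∧
      ‖Complex.exp (edgePhase a b z l) * ((u l - du l / z) / 2) - (u 0 - du 0 / z) / 2‖ ≤
          ε * (‖(u 0 + du 0 / z) / 2‖ + ‖(u 0 - du 0 / z) / 2‖) := by
  set M := Real.exp (2 * (R * l + 2 * C * l)) with hM
  have hM0 : 0 < M := Real.exp_pos _
  set D := 2 * C * M with hD
  have hD0 : 0 ≤ D := by positivity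
  -- The value 1/2 is the smallness required by `norm_sub_le_of_oscillating`; ε/2 compensates the
  -- factor 2 in its conclusion.
  set η := min (1 / 2) (ε / 2) / (1 + D * l) with hη
  have hη0 : 0 < η := by positivity
  have hηD : η * (1 + D * l) = min (1 / 2) (ε / 2) := div_mul_cancel₀ _ (by positivity)
  have hre : ∀ᶠ z in highFrequencyFilter R, |z.re| ≤ R :=
    eventually_highFrequencyFilter.2 ⟨0, fun z h _ => h⟩
  filter_upwards [(tendsto_norm_highFrequencyFilter R).eventually_ge_atTop 1, hre,
    eventually_norm_integral_damping_exp_le hl hC0 ha hb haC hbC R (s := 1) (by simp) hη0,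
    eventually_norm_integral_damping_exp_le hl hC0 ha hb haC hbC R (s := -1) (by simp) hη0]
    with z hz hzR hp hm u du h
  have hzne : z ≠ 0 := norm_pos_iff.1 (by linarith)
  have hθ := continuousOn_edgePhase hl.le ha hb haC hbC hz
  have hθ' := fun x (hx : x ∈ Set.Ioo 0 l) => hasDerivAt_edgePhase ha hb haC hbC hz hx
  have hsub := Set.Ioo_subset_Icc_self (a := (0 : ℝ)) (b := l)
  have hα := continuousOn_edgeDamping ha hb z
  have hαC := norm_edgeDamping_le haC hbC hz
  have hκ := continuousOn_coefficient ha hb z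
  have hu' := fun x (hx : x ∈ Set.Ioo 0 l) => h.hasDerivAt_fst hx
  have hdu' := fun x (hx : x ∈ Set.Ioo 0 l) => h.hasDerivAt_snd hκ
    (fun x hx => norm_coefficient_le z (haC x hx) (hbC x hx)) hx
  have hcoef : ∀ x, z ^ 2 + 2 * z * a x - b x = z ^ 2 + 2 * z * edgeDamping a b z x := fun x => by
    simp only [edgeDamping]
    field_simp
    ring
  -- Writing k = z² + 2zα exactly, the exponentials of the phase remove the diagonal terms z + α and
  -- -(z + α) from the system for (u ± u'/z)/2; only the oscillating off-diagonal coefficients g and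
  -- k remain.
  set P : ℝ → ℂ := fun x => Complex.exp (-edgePhase a b z x) * ((u x + du x / z) / 2) with hP
  set Q : ℝ → ℂ := fun x => Complex.exp (edgePhase a b z x) * ((u x - du x / z) / 2) with hQ
  set g : ℝ → ℂ := fun x => edgeDamping a b z x *
    Complex.exp (2 * ((-1 : ℝ) : ℂ) * edgePhase a b z x) with hg
  set k : ℝ → ℂ := fun x => -(edgeDamping a b z x *
    Complex.exp (2 * ((1 : ℝ) : ℂ) * edgePhase a b z x)) with hk
  have hPc : ContinuousOn P (Set.Icc 0 l) :=
    (Complex.continuous_exp.comp_continuousOn hθ.neg).mul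
      ((h.continuousOn_fst.add (h.continuousOn_snd.div_const _)).div_const _)
  have hQc : ContinuousOn Q (Set.Icc 0 l) :=
    (Complex.continuous_exp.comp_continuousOn hθ).mul
      ((h.continuousOn_fst.sub (h.continuousOn_snd.div_const _)).div_const _)
  have hgc : ContinuousOn g (Set.Ioo 0 l) :=
    hα.mul (Complex.continuous_exp.comp_continuousOn (continuousOn_const.mul (hθ.mono hsub)))
  have hkc : ContinuousOn k (Set.Ioo 0 l) :=
    (hα.mul (Complex.continuous_exp.comp_continuousOn
      (continuousOn_const.mul (hθ.mono hsub)))).neg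
  have hPd : ∀ x ∈ Set.Ioo 0 l, HasDerivAt P (g x * Q x) x := by
    intro x hx
    have h1 := ((hθ' x hx).neg.cexp).mul
      (((hu' x hx).add ((hdu' x hx).div_const z)).div_const 2)
    refine h1.congr_deriv ?_
    have e : Complex.exp (2 * ((-1 : ℝ) : ℂ) * edgePhase a b z x) *
        Complex.exp (edgePhase a b z x) = Complex.exp (-edgePhase a b z x) := by
      rw [← Complex.exp_add]
      congr 1
      push_cast
      ring
    simp only [hg, hQ, Pi.add_apply, Pi.neg_apply]
    rw [show ∀ A B D F : ℂ, A * B * (D * F) = A * (B * D) * F from fun _ _ _ _ => by ring, e,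
      hcoef]
    field_simp
    ring
  have hQd : ∀ x ∈ Set.Ioo 0 l, HasDerivAt Q (k x * P x) x := by
    intro x hx
    have h1 := ((hθ' x hx).cexp).mul
      (((hu' x hx).sub ((hdu' x hx).div_const z)).div_const 2)
    refine h1.congr_deriv ?_
    have e : Complex.exp (2 * ((1 : ℝ) : ℂ) * edgePhase a b z x) *
        Complex.exp (-edgePhase a b z x) = Complex.exp (edgePhase a b z x) := by
      rw [← Complex.exp_add]
      congr 1
      push_cast
      ring
    simp only [hk, hP, Pi.sub_apply]
    rw [show ∀ A B D F : ℂ, -(A * B) * (D * F) = -(A * (B * D) * F) from fun _ _ _ _ => by ring, e,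
      hcoef]
    field_simp
    ring
  have hgD : ∀ x ∈ Set.Ioo 0 l, ‖g x‖ ≤ D := fun x hx => by
    rw [hg, norm_mul]
    exact mul_le_mul (hαC x hx) (norm_exp_edgePhase_le hC0 haC hbC hz hzR (by simp) (hsub hx))
      (norm_nonneg _) (by positivity)
  have hkD : ∀ x ∈ Set.Ioo 0 l, ‖k x‖ ≤ D := fun x hx => by
    rw [hk, norm_neg, norm_mul]
    exact mul_le_mul (hαC x hx) (norm_exp_edgePhase_le hC0 haC hbC hz hzR (by simp) (hsub hx))
      (norm_nonneg _) (by positivity)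
  have key := norm_sub_le_of_oscillating hl hPc hQc hgc hkc hPd hQd hgD hkD hm
    (fun x hx => by
      simp only [hk]
      rw [intervalIntegral.integral_neg, norm_neg]
      exact hp x hx) hD0 (by rw [hηD]; exact min_le_left _ _) (Set.right_mem_Icc.2 hl.le)
  have hP0 : P 0 = (u 0 + du 0 / z) / 2 := by simp [hP, edgePhase_zero]
  have hQ0 : Q 0 = (u 0 - du 0 / z) / 2 := by simp [hQ, edgePhase_zero]
  rw [hP0, hQ0, hηD] at key
  have h2 : 2 * min (1 / 2) (ε / 2) ≤ ε := by linarith [min_le_right (1 / 2) (ε / 2)]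
  exact ⟨key.1.trans (by gcongr), key.2.trans (by gcongr)⟩

end

/-! ### Scattering matrices of an edge. -/

section

open Asymptotics

lemma edgePhase_eq {l : ℝ} {a b : ℝ → ℝ} (ha : IntervalIntegrable a volume 0 l)
    (hb : IntervalIntegrable b volume 0 l) (z : ℂ) :
    edgePhase a b z l = z * l + (∫ t in (0 : ℝ)..l, a t : ℝ) -
      (∫ t in (0 : ℝ)..l, b t : ℝ) / (2 * z) := by
  have ha' : IntervalIntegrable (fun t => (a t : ℂ)) volume 0 l := ⟨ha.1.ofReal, ha.2.ofReal⟩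
  have hb' : IntervalIntegrable (fun t => (b t : ℂ)) volume 0 l := ⟨hb.1.ofReal, hb.2.ofReal⟩
  simp only [edgePhase, edgeDamping]
  rw [intervalIntegral.integral_sub ha' (hb'.div_const _), intervalIntegral.integral_div,
    intervalIntegral.integral_ofReal, intervalIntegral.integral_ofReal]
  ring

lemma tendsto_inv_highFrequencyFilter (R : ℝ) :
    Tendsto (fun z : ℂ => z⁻¹) (highFrequencyFilter R) (𝓝 0) := by
  rw [tendsto_zero_iff_norm_tendsto_zero]
  exact (tendsto_norm_highFrequencyFilter R).inv_tendsto_atTop.congr fun z => (norm_inv z).symm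

lemma eventually_abs_re_le (R : ℝ) : ∀ᶠ z in highFrequencyFilter R, |z.re| ≤ R :=
  eventually_highFrequencyFilter.2 ⟨0, fun _ h _ => h⟩

lemma isBigO_exp_highFrequencyFilter (R l A : ℝ) :
    (fun z : ℂ => Complex.exp (z * l + A)) =O[highFrequencyFilter R] (fun _ => (1 : ℝ)) := by
  refine IsBigO.of_bound (Real.exp (R * |l| + A)) ?_
  filter_upwards [eventually_abs_re_le R] with z hz
  rw [Complex.norm_exp, norm_one, mul_one]
  refine Real.exp_le_exp.2 ?_
  rw [Complex.add_re, Complex.re_mul_ofReal, Complex.ofReal_re]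
  have : z.re * l ≤ R * |l| := (le_abs_self _).trans (by rw [abs_mul]; gcongr)
  linarith

/-- Lets bounded exponential factors be moved across limits: these factors stay bounded in a strip
but have no limit themselves. -/
lemma tendsto_zero_of_isBigO_mul {α : Type*} {F : Filter α} {f g h : α → ℂ}
    (hf : f =O[F] (fun _ => (1 : ℝ))) (hg : Tendsto g F (𝓝 0)) (he : ∀ᶠ z in F, h z = f z * g z) :
    Tendsto h F (𝓝 0) := by
  have h1 := hf.mul_isLittleO ((isLittleO_one_iff ℝ).2 hg)
  simp only [mul_one] at h1
  exact ((isLittleO_one_iff ℝ).1 h1).congr' (he.mono fun z hz => hz.symm)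

/-- The scattering description of an edge: the matrices `o` and `i` express the amplitudes of the
waves leaving and entering the two end points by a vector of parameters of the solutions. -/
theorem exists_edge_scattering {l : ℝ} (hl : 0 < l) {a b : ℝ → ℝ} {C : ℝ} (hC0 : 0 ≤ C)
    (ha : ContinuousOn a (Set.Ioo 0 l)) (hb : ContinuousOn b (Set.Ioo 0 l))
    (haC : ∀ x ∈ Set.Ioo 0 l, |a x| ≤ C) (hbC : ∀ x ∈ Set.Ioo 0 l, |b x| ≤ C) :
    ∃ o i : ℂ → Matrix (Fin 2) (Fin 2) ℂ,
      (∀ p q, ∀ z ≠ 0, DifferentiableAt ℂ (fun z => o z p q) z ∧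
        DifferentiableAt ℂ (fun z => i z p q) z) ∧
      (∀ z ≠ 0, ∀ u du, IsEdgeSolution l (fun x => z ^ 2 + 2 * z * a x - b x) u du →
        ∃ x : Fin 2 → ℂ, (o z).mulVec x + (i z).mulVec x = ![u 0, u l] ∧
          z • ((o z).mulVec x - (i z).mulVec x) = ![du 0, -du l] ∧
          (x = 0 → ∀ y ∈ Set.Icc 0 l, u y = 0)) ∧
      (∀ z ≠ 0, ∀ x : Fin 2 → ℂ, ∃ u du,
        IsEdgeSolution l (fun x => z ^ 2 + 2 * z * a x - b x) u du ∧
          (o z).mulVec x + (i z).mulVec x = ![u 0, u l] ∧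
          z • ((o z).mulVec x - (i z).mulVec x) = ![du 0, -du l] ∧
          ((∀ y ∈ Set.Icc 0 l, u y = 0) → x = 0)) ∧
      ∀ R p q,
        Tendsto (fun z => o z p q) (highFrequencyFilter R) (𝓝 ((1 : Matrix (Fin 2) (Fin 2) ℂ) p q)) ∧
        Tendsto (fun z => i z p q -
          (!![0, Complex.exp (z * l + (∫ t in (0 : ℝ)..l, a t : ℝ));
            Complex.exp (z * l + (∫ t in (0 : ℝ)..l, a t : ℝ)), 0] : Matrix (Fin 2) (Fin 2) ℂ) p q)
          (highFrequencyFilter R) (𝓝 0) := by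
  obtain ⟨T, hTd, hTsol, hTex, hTuniq⟩ := exists_transfer_matrix hl.le hC0 ha hb haC hbC
  have hai : IntervalIntegrable a volume 0 l :=
    intervalIntegrable_of_bounded_continuousOn hl.le ha haC
  have hbi : IntervalIntegrable b volume 0 l :=
    intervalIntegrable_of_bounded_continuousOn hl.le hb hbC
  set A : ℝ := ∫ t in (0 : ℝ)..l, a t with hA
  set B : ℝ := ∫ t in (0 : ℝ)..l, b t with hB
  set θ : ℂ → ℂ := fun z => edgePhase a b z l with hθ
  have hθe : ∀ z, θ z = z * l + A - B / (2 * z) := edgePhase_eq hai hbi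
  have hθd : ∀ z ≠ 0, DifferentiableAt ℂ θ z := fun z hz => by
    rw [funext hθe]
    fun_prop (disch := simpa using hz)
  -- The parameters are x₀ = (u + u'/z)/2 at 0 and x₁ with e^{θ}x₁ = (u - u'/z)/2 at 0. The factor
  -- e^{θ} makes x₁ asymptotic to the amplitude (u - u'/z)/2 at l, so x approximates the waves
  -- leaving both ends and the outgoing matrix tends to 1. The p's give (u + u'/z)/2 at l, the q's
  -- (u - u'/z)/2, through the transfer matrix and hence holomorphically off 0.
  set p₀ : ℂ → ℂ := fun z => (T z 0 0 + T z 1 0 / z + z * T z 0 1 + T z 1 1) / 2 with hp₀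
  set p₁ : ℂ → ℂ := fun z =>
    Complex.exp (θ z) * ((T z 0 0 + T z 1 0 / z - z * T z 0 1 - T z 1 1) / 2) with hp₁
  set q₀ : ℂ → ℂ := fun z => (T z 0 0 - T z 1 0 / z + z * T z 0 1 - T z 1 1) / 2 with hq₀
  set q₁ : ℂ → ℂ := fun z =>
    Complex.exp (θ z) * ((T z 0 0 - T z 1 0 / z - z * T z 0 1 + T z 1 1) / 2) with hq₁
  have hends : ∀ z ≠ 0, ∀ u du (x : Fin 2 → ℂ),
      IsEdgeSolution l (fun x => z ^ 2 + 2 * z * a x - b x) u du →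
      u 0 = x 0 + Complex.exp (θ z) * x 1 → du 0 = z * (x 0 - Complex.exp (θ z) * x 1) →
      p₀ z * x 0 + p₁ z * x 1 = (u l + du l / z) / 2 ∧
      q₀ z * x 0 + q₁ z * x 1 = (u l - du l / z) / 2 := by
    intro z hz u du x h h0 h1
    obtain ⟨e1, e2⟩ := hTsol z u du h
    rw [e1, e2, h0, h1]
    simp only [hp₀, hp₁, hq₀, hq₁]
    constructor <;> (field_simp; ring)
  have hmul : ∀ z ≠ 0, ∀ u du (x : Fin 2 → ℂ),
      IsEdgeSolution l (fun x => z ^ 2 + 2 * z * a x - b x) u du →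
      u 0 = x 0 + Complex.exp (θ z) * x 1 → du 0 = z * (x 0 - Complex.exp (θ z) * x 1) →
      (!![1, 0; q₀ z, q₁ z] : Matrix (Fin 2) (Fin 2) ℂ).mulVec x +
        (!![0, Complex.exp (θ z); p₀ z, p₁ z] : Matrix (Fin 2) (Fin 2) ℂ).mulVec x =
          ![u 0, u l] ∧
      z • ((!![1, 0; q₀ z, q₁ z] : Matrix (Fin 2) (Fin 2) ℂ).mulVec x -
        (!![0, Complex.exp (θ z); p₀ z, p₁ z] : Matrix (Fin 2) (Fin 2) ℂ).mulVec x) =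
          ![du 0, -du l] := by
    intro z hz u du x h h0 h1
    obtain ⟨e1, e2⟩ := hends z hz u du x h h0 h1
    constructor
    · ext e
      fin_cases e
      · simp [dotProduct, Fin.sum_univ_two, h0]
      · simp only [Matrix.mulVec, dotProduct, Fin.sum_univ_two, Pi.add_apply]
        simp
        rw [e1, e2]
        ring
    · ext e
      fin_cases e
      · simp [dotProduct, Fin.sum_univ_two, h1]
      · simp only [Matrix.mulVec, dotProduct, Fin.sum_univ_two, Pi.sub_apply, Pi.smul_apply]
        simp
        rw [e1, e2]
        field_simp
        ring
  refine ⟨fun z => !![1, 0; q₀ z, q₁ z], fun z => !![0, Complex.exp (θ z); p₀ z, p₁ z],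
    ?_, ?_, ?_, ?_⟩
  · intro p q z hz
    have hd := fun i j => hTd i j z
    have hθz := hθd z hz
    have d1 : DifferentiableAt ℂ q₀ z := by
      simp only [hq₀]
      fun_prop (disch := assumption)
    have d2 : DifferentiableAt ℂ q₁ z := by
      simp only [hq₁]
      fun_prop (disch := assumption)
    have d3 : DifferentiableAt ℂ p₀ z := by
      simp only [hp₀]
      fun_prop (disch := assumption)
    have d4 : DifferentiableAt ℂ p₁ z := by
      simp only [hp₁]
      fun_prop (disch := assumption)
    fin_cases p <;> fin_cases q
    · exact ⟨differentiableAt_const _, differentiableAt_const _⟩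
    · exact ⟨differentiableAt_const _, hθz.cexp⟩
    · exact ⟨d1, d3⟩
    · exact ⟨d2, d4⟩
  · intro z hz u du h
    set x : Fin 2 → ℂ := ![(u 0 + du 0 / z) / 2, Complex.exp (-θ z) * ((u 0 - du 0 / z) / 2)]
      with hx
    have hx1 : Complex.exp (θ z) * x 1 = (u 0 - du 0 / z) / 2 := by
      simp only [hx, Matrix.cons_val_one, Matrix.cons_val_fin_one]
      rw [← mul_assoc, ← Complex.exp_add, add_neg_cancel, Complex.exp_zero, one_mul]
    have hx0 : x 0 = (u 0 + du 0 / z) / 2 := rfl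
    have h0 : u 0 = x 0 + Complex.exp (θ z) * x 1 := by rw [hx1, hx0]; ring
    have h1 : du 0 = z * (x 0 - Complex.exp (θ z) * x 1) := by
      rw [hx1, hx0]; field_simp; ring
    obtain ⟨m1, m2⟩ := hmul z hz u du x h h0 h1
    refine ⟨x, m1, m2, fun hx => ?_⟩
    exact hTuniq z u du h (by rw [h0, hx]; simp) (by rw [h1, hx]; simp)
  · intro z hz x
    obtain ⟨u, du, h, h0, h1⟩ := hTex z (x 0 + Complex.exp (θ z) * x 1)
      (z * (x 0 - Complex.exp (θ z) * x 1))
    obtain ⟨m1, m2⟩ := hmul z hz u du x h h0 h1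
    refine ⟨u, du, h, m1, m2, fun hu => ?_⟩
    -- If u vanishes, the integrated equation makes u' constant, and the integral of u' over the
    -- edge is zero, so that constant is zero.
    have hdu : ∀ y ∈ Set.Icc 0 l, du y = du 0 := by
      intro y hy
      rw [h.snd_eq y hy]
      have : ∫ t in (0 : ℝ)..y, (z ^ 2 + 2 * z * a t - b t) * u t = ∫ t in (0 : ℝ)..y, (0 : ℂ) := by
        refine intervalIntegral.integral_congr fun t ht => ?_
        rw [Set.uIcc_of_le hy.1] at ht
        simp only [hu t ⟨ht.1, ht.2.trans hy.2⟩, mul_zero]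
      rw [this]
      simp
    have hu0 : u 0 = 0 := hu 0 (Set.left_mem_Icc.2 hl.le)
    have hdu0 : du 0 = 0 := by
      have e := h.fst_eq l (Set.right_mem_Icc.2 hl.le)
      rw [hu l (Set.right_mem_Icc.2 hl.le), hu0, zero_add,
        intervalIntegral.integral_congr (g := fun _ => du 0) (fun t ht => by
          rw [Set.uIcc_of_le hl.le] at ht
          exact hdu t ht), intervalIntegral.integral_const] at e
      simpa [hl.ne'] using e.symm
    rw [hu0] at h0
    rw [hdu0] at h1
    have h2 : x 0 - Complex.exp (θ z) * x 1 = 0 := (mul_eq_zero.1 h1.symm).resolve_left hz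
    have h3 : x 0 = 0 := by linear_combination (-(1 / 2) : ℂ) * h0 + (1 / 2 : ℂ) * h2
    have h4 : Complex.exp (θ z) * x 1 = 0 := by rw [h3, zero_sub] at h2; exact neg_eq_zero.1 h2
    have h5 : x 1 = 0 := (mul_eq_zero.1 h4).resolve_left (Complex.exp_ne_zero _)
    ext e
    fin_cases e
    · exact h3
    · exact h5
  · intro R
    have hne : ∀ᶠ z in highFrequencyFilter R, z ≠ 0 := by
      filter_upwards [(tendsto_norm_highFrequencyFilter R).eventually_ge_atTop 1] with z hz
      exact norm_pos_iff.1 (by linarith)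
    have hexp : (fun z => Complex.exp (θ z)) =O[highFrequencyFilter R] (fun _ => (1 : ℝ)) := by
      refine IsBigO.of_bound (Real.exp (R * l + 2 * C * l)) ?_
      filter_upwards [eventually_abs_re_le R,
        (tendsto_norm_highFrequencyFilter R).eventually_ge_atTop 1] with z hz hz1
      rw [Complex.norm_exp, norm_one, mul_one]
      exact Real.exp_le_exp.2 ((le_abs_self _).trans
        (abs_re_edgePhase_le hC0 haC hbC hz1 hz (Set.right_mem_Icc.2 hl.le)))
    have hexpn : (fun z => Complex.exp (-θ z)) =O[highFrequencyFilter R] (fun _ => (1 : ℝ)) := by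
      refine IsBigO.of_bound (Real.exp (R * l + 2 * C * l)) ?_
      filter_upwards [eventually_abs_re_le R,
        (tendsto_norm_highFrequencyFilter R).eventually_ge_atTop 1] with z hz hz1
      rw [Complex.norm_exp, norm_one, mul_one, Complex.neg_re]
      exact Real.exp_le_exp.2 ((neg_le_abs _).trans
        (abs_re_edgePhase_le hC0 haC hbC hz1 hz (Set.right_mem_Icc.2 hl.le)))
    have hexplim : Tendsto (fun z => Complex.exp (θ z) - Complex.exp (z * l + A))
        (highFrequencyFilter R) (𝓝 0) := by
      refine tendsto_zero_of_isBigO_mul (isBigO_exp_highFrequencyFilter R l A)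
        (g := fun z => Complex.exp (-(B / 2) * z⁻¹) - 1) ?_ (Eventually.of_forall fun z => ?_)
      · have h1 : Tendsto (fun z : ℂ => -(B / 2 : ℂ) * z⁻¹) (highFrequencyFilter R) (𝓝 0) := by
          simpa using (tendsto_inv_highFrequencyFilter R).const_mul (-(B / 2 : ℂ))
        have h2 := (Complex.continuous_exp.tendsto 0).comp h1
        rw [Complex.exp_zero] at h2
        simpa using h2.sub_const 1
      · rw [mul_sub, mul_one, ← Complex.exp_add, hθe]
        congr 2
        ring
    have hfund : ∀ ε > 0, ∀ᶠ z in highFrequencyFilter R, ∀ x : Fin 2 → ℂ,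
        ‖Complex.exp (-θ z) * (p₀ z * x 0 + p₁ z * x 1) - x 0‖ ≤
          ε * (‖x 0‖ + ‖Complex.exp (θ z) * x 1‖) ∧
        ‖Complex.exp (θ z) * (q₀ z * x 0 + q₁ z * x 1) - Complex.exp (θ z) * x 1‖ ≤
          ε * (‖x 0‖ + ‖Complex.exp (θ z) * x 1‖) := by
      intro ε hε
      filter_upwards [eventually_edge_amplitudes hl hC0 ha hb haC hbC R hε, hne] with z hz hz0 x
      obtain ⟨u, du, h, h0, h1⟩ := hTex z (x 0 + Complex.exp (θ z) * x 1)
        (z * (x 0 - Complex.exp (θ z) * x 1))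
      obtain ⟨e1, e2⟩ := hends z hz0 u du x h h0 h1
      have e3 : (u 0 + du 0 / z) / 2 = x 0 := by rw [h0, h1]; field_simp; ring
      have e4 : (u 0 - du 0 / z) / 2 = Complex.exp (θ z) * x 1 := by
        rw [h0, h1]; field_simp; ring
      have := hz u du h
      rwa [← e1, ← e2, e3, e4] at this
    have hlim : ∀ f : ℂ → ℂ, (∀ ε > 0, ∀ᶠ z in highFrequencyFilter R, ‖f z‖ ≤ ε) →
        Tendsto f (highFrequencyFilter R) (𝓝 0) := fun f hf => by
      rw [Metric.tendsto_nhds]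
      intro ε hε
      filter_upwards [hf (ε / 2) (half_pos hε)] with z hz
      rw [dist_zero_right]
      linarith
    have l1 : Tendsto (fun z => Complex.exp (-θ z) * p₀ z - 1) (highFrequencyFilter R) (𝓝 0) :=
      hlim _ fun ε hε => (hfund ε hε).mono fun z hz => by simpa using (hz ![1, 0]).1
    have l2 : Tendsto (fun z => Complex.exp (θ z) * q₀ z) (highFrequencyFilter R) (𝓝 0) :=
      hlim _ fun ε hε => (hfund ε hε).mono fun z hz => by simpa using (hz ![1, 0]).2
    have hcancel : ∀ z, Complex.exp (θ z) * Complex.exp (-θ z) = 1 := fun z => by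
      rw [← Complex.exp_add, add_neg_cancel, Complex.exp_zero]
    -- The choice x₁ = e^{-θ} normalizes e^{θ}x₁ to 1, so that the amplitude bound becomes ε itself.
    have l3 : Tendsto (fun z => Complex.exp (-θ z) * (p₁ z * Complex.exp (-θ z)))
        (highFrequencyFilter R) (𝓝 0) :=
      hlim _ fun ε hε => (hfund ε hε).mono fun z hz => by
        simpa [← mul_assoc, hcancel] using (hz ![0, Complex.exp (-θ z)]).1
    have l4 : Tendsto (fun z => q₁ z - 1) (highFrequencyFilter R) (𝓝 0) :=
      hlim _ fun ε hε => (hfund ε hε).mono fun z hz => by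
        have h1 := (hz ![0, Complex.exp (-θ z)]).2
        have e : Complex.exp (θ z) * (q₁ z * Complex.exp (-θ z)) = q₁ z := by
          rw [mul_left_comm, hcancel, mul_one]
        simpa [hcancel, e] using h1
    have c1 : Tendsto (fun z => p₀ z - Complex.exp (z * l + A)) (highFrequencyFilter R) (𝓝 0) := by
      have := (tendsto_zero_of_isBigO_mul hexp l1 (Eventually.of_forall fun z => rfl)).add hexplim
      rw [add_zero] at this
      refine this.congr fun z => ?_
      linear_combination p₀ z * hcancel z
    have c2 : Tendsto q₀ (highFrequencyFilter R) (𝓝 0) :=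
      tendsto_zero_of_isBigO_mul hexpn l2 (Eventually.of_forall fun z => by
        linear_combination -q₀ z * hcancel z)
    have c3 : Tendsto p₁ (highFrequencyFilter R) (𝓝 0) := by
      refine tendsto_zero_of_isBigO_mul hexp
        (tendsto_zero_of_isBigO_mul hexp l3 (Eventually.of_forall fun z => rfl))
        (Eventually.of_forall fun z => ?_)
      linear_combination
        (-p₁ z) * (1 + Complex.exp (θ z) * Complex.exp (-θ z)) * hcancel z
    have c4 : Tendsto q₁ (highFrequencyFilter R) (𝓝 1) := by
      simpa using l4.add_const 1
    intro p q
    fin_cases p <;> fin_cases q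
    · exact ⟨by simpa using tendsto_const_nhds, by simpa using tendsto_const_nhds⟩
    · exact ⟨by simpa using tendsto_const_nhds, by simpa using hexplim⟩
    · exact ⟨by simpa using c2, by simpa using c1⟩
    · exact ⟨by simpa using c4, by simpa using c3⟩

/-! ### The secular polynomial of the graph. -/

/-- The block diagonal matrix on the edge ends with one block for each edge. -/
def edgeBlocks {N : ℕ} {R : Type*} [Zero R] (o : Fin N → Matrix (Fin 2) (Fin 2) R) :
    Matrix (Fin N × Fin 2) (Fin N × Fin 2) R :=
  Matrix.of fun p q => if p.1 = q.1 then o p.1 p.2 q.2 else 0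

lemma edgeBlocks_mulVec {N : ℕ} {R : Type*} [CommRing R] (o : Fin N → Matrix (Fin 2) (Fin 2) R)
    (x : Fin N × Fin 2 → R) (j : Fin N) (e : Fin 2) :
    (edgeBlocks o).mulVec x (j, e) = (o j).mulVec (fun f => x (j, f)) e := by
  simp [edgeBlocks, Matrix.mulVec, dotProduct, Fintype.sum_prod_type, ite_mul]

lemma edgeBlocks_mul {N : ℕ} {R : Type*} [CommRing R] (o o' : Fin N → Matrix (Fin 2) (Fin 2) R) :
    edgeBlocks o * edgeBlocks o' = edgeBlocks fun j => o j * o' j := by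
  ext ⟨j, e⟩ ⟨k, f⟩
  have := edgeBlocks_mulVec o (fun p => edgeBlocks o' p (k, f)) j e
  rw [Matrix.mul_apply]
  refine Eq.trans this ?_
  by_cases h : j = k
  · subst h
    simp [edgeBlocks, Matrix.mulVec, dotProduct, Matrix.mul_apply]
  · simp [edgeBlocks, Matrix.mulVec, dotProduct, h]

lemma edgeBlocks_one {N : ℕ} {R : Type*} [CommRing R] :
    edgeBlocks (fun _ : Fin N => (1 : Matrix (Fin 2) (Fin 2) R)) = 1 := by
  ext ⟨j, e⟩ ⟨k, f⟩
  by_cases h : j = k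
  · subst h
    simp [edgeBlocks, Matrix.one_apply]
  · simp [edgeBlocks, Matrix.one_apply, h]

/-- Telescoping, XX' - YY' = X'(X - Y) + Y(X' - Y'); the boundedness of the products of the Y's is
carried along in the induction. -/
lemma tendsto_prod_sub_prod {α ι : Type*} {F : Filter α} (s : Finset ι) {X Y : ι → α → ℂ}
    (hXY : ∀ i ∈ s, Tendsto (fun z => X i z - Y i z) F (𝓝 0))
    (hY : ∀ i ∈ s, (Y i) =O[F] (fun _ => (1 : ℝ))) :
    Tendsto (fun z => ∏ i ∈ s, X i z - ∏ i ∈ s, Y i z) F (𝓝 0) ∧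
      (fun z => ∏ i ∈ s, Y i z) =O[F] (fun _ => (1 : ℝ)) := by
  classical
  induction s using Finset.induction_on with
  | empty =>
    simp only [Finset.prod_empty, sub_self]
    exact ⟨tendsto_const_nhds, isBigO_const_const _ one_ne_zero _⟩
  | insert i s hi ih =>
    obtain ⟨h1, h2⟩ := ih (fun j hj => hXY j (Finset.mem_insert_of_mem hj))
      (fun j hj => hY j (Finset.mem_insert_of_mem hj))
    have h3 := hXY i (Finset.mem_insert_self i s)
    have h4 := hY i (Finset.mem_insert_self i s)
    simp only [Finset.prod_insert hi]
    constructor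
    · have hX : (fun z => ∏ i ∈ s, X i z) =O[F] (fun _ => (1 : ℝ)) := by
        have := ((isLittleO_one_iff ℝ).2 h1).isBigO.add h2
        simpa using this
      have e1 := tendsto_zero_of_isBigO_mul hX h3 (Eventually.of_forall fun z => rfl)
      have e2 := tendsto_zero_of_isBigO_mul h4 h1 (Eventually.of_forall fun z => rfl)
      have e3 := e1.add e2
      rw [add_zero] at e3
      exact e3.congr fun z => by ring
    · simpa using h4.mul h2

/-- Asymptotically equal bounded matrices have asymptotically equal determinants. -/
lemma tendsto_det_sub_det {α n : Type*} [Fintype n] [DecidableEq n] {F : Filter α}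
    {X Y : α → Matrix n n ℂ} (hXY : Tendsto (fun z => X z - Y z) F (𝓝 0))
    (hY : ∀ i j, (fun z => Y z i j) =O[F] (fun _ => (1 : ℝ))) :
    Tendsto (fun z => (X z).det - (Y z).det) F (𝓝 0) := by
  simp only [Matrix.det_apply, ← Finset.sum_sub_distrib, ← smul_sub]
  rw [← Finset.sum_const_zero (s := (Finset.univ : Finset (Equiv.Perm n)))]
  refine tendsto_finsetSum _ fun σ _ => ?_
  have := (tendsto_prod_sub_prod Finset.univ (X := fun i z => X z (σ i) i)
    (Y := fun i z => Y z (σ i) i) (F := F) (fun i _ => ?_) fun i _ => hY _ _).1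
  · have h2 := this.const_smul (Equiv.Perm.sign σ)
    rwa [smul_zero] at h2
  · exact ((continuous_apply_apply (σ i) i).tendsto (0 : Matrix n n ℂ)).comp hXY

open Polynomial in
/-- The limit secular polynomial: `S` is the vertex scattering matrix at infinite frequency and
`A j` the total damping of the edge `j`. -/
noncomputable def secularPolynomial {N : ℕ} (m : Fin N → ℕ) (A : Fin N → ℝ)
    (S : Matrix (Fin N × Fin 2) (Fin N × Fin 2) ℂ) : ℂ[X] :=
  (1 - S.map C * edgeBlocks fun j =>
    !![0, C (Complex.exp (A j)) * X ^ m j; C (Complex.exp (A j)) * X ^ m j, 0]).det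

lemma secularPolynomial_eval {N : ℕ} (m : Fin N → ℕ) (A : Fin N → ℝ)
    (S : Matrix (Fin N × Fin 2) (Fin N × Fin 2) ℂ) (w : ℂ) :
    (secularPolynomial m A S).eval w = (1 - S * edgeBlocks fun j =>
      !![0, Complex.exp (A j) * w ^ m j; Complex.exp (A j) * w ^ m j, 0]).det := by
  rw [secularPolynomial, ← Polynomial.coe_evalRingHom, RingHom.map_det]
  congr 1
  rw [map_sub, map_one, map_mul]
  congr 2
  · ext p q
    simp
  · ext ⟨j, e⟩ ⟨k, f⟩
    by_cases h : j = k
    · subst h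
      fin_cases e <;> fin_cases f <;> simp [edgeBlocks]
    · simp [edgeBlocks, h]

/-- Guarantees that the roots in w are nonzero and hence of the form e^{l₀c}. -/
lemma secularPolynomial_eval_zero {N : ℕ} {m : Fin N → ℕ} (hm : ∀ j, 0 < m j) (A : Fin N → ℝ)
    (S : Matrix (Fin N × Fin 2) (Fin N × Fin 2) ℂ) : (secularPolynomial m A S).eval 0 = 1 := by
  rw [secularPolynomial_eval]
  have : (edgeBlocks fun j => !![0, Complex.exp (A j) * 0 ^ m j; Complex.exp (A j) * 0 ^ m j, 0]) =
      (0 : Matrix (Fin N × Fin 2) (Fin N × Fin 2) ℂ) := by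
    ext ⟨j, e⟩ ⟨k, f⟩
    fin_cases e <;> fin_cases f <;> simp [edgeBlocks, (hm _).ne']
  rw [this, mul_zero, sub_zero, Matrix.det_one]

/-- Both columns of the edge j have degree at most m_j, which bounds the degree by 2∑m_j. As m_j >
0, the identity matrix does not contribute to the top coefficients, and the leading coefficient is
det(-SB'), nonzero because S² = 1 and B' is invertible. -/
lemma secularPolynomial_natDegree {N : ℕ} {m : Fin N → ℕ} (hm : ∀ j, 0 < m j) (A : Fin N → ℝ)
    {S : Matrix (Fin N × Fin 2) (Fin N × Fin 2) ℂ} (hS : S * S = 1) :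
    (secularPolynomial m A S).natDegree = 2 * ∑ j, m j := by
  open Polynomial in
  set B : Matrix (Fin N × Fin 2) (Fin N × Fin 2) ℂ[X] := edgeBlocks fun j =>
    !![0, C (Complex.exp (A j)) * X ^ m j; C (Complex.exp (A j)) * X ^ m j, 0] with hB
  set B' : Matrix (Fin N × Fin 2) (Fin N × Fin 2) ℂ := edgeBlocks fun j =>
    !![0, Complex.exp (A j); Complex.exp (A j), 0] with hB'
  have hBdeg : ∀ p q, (B p q).natDegree ≤ m q.1 := by
    rintro ⟨j, e⟩ ⟨k, f⟩
    by_cases h : j = k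
    · subst h
      fin_cases e <;> fin_cases f <;> simp [hB, edgeBlocks, Complex.exp_ne_zero]
    · simp [hB, edgeBlocks, h]
  have hBcoeff : ∀ p q, (B p q).coeff (m q.1) = B' p q := by
    rintro ⟨j, e⟩ ⟨k, f⟩
    by_cases h : j = k
    · subst h
      fin_cases e <;> fin_cases f <;> simp [hB, hB', edgeBlocks]
    · simp [hB, hB', edgeBlocks, h]
  have hsum : ∑ q : Fin N × Fin 2, m q.1 = 2 * ∑ j, m j := by
    rw [Fintype.sum_prod_type, Finset.mul_sum]
    simp
  have hentry : ∀ p q, (1 - S.map Polynomial.C * B) p q =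
      (1 : Matrix (Fin N × Fin 2) (Fin N × Fin 2) (Polynomial ℂ)) p q -
        ∑ r, Polynomial.C (S p r) * B r q := fun p q => by
    simp [Matrix.sub_apply, Matrix.mul_apply]
  have hone : ∀ p q, (1 : Matrix (Fin N × Fin 2) (Fin N × Fin 2) (Polynomial ℂ)) p q =
      Polynomial.C ((1 : Matrix (Fin N × Fin 2) (Fin N × Fin 2) ℂ) p q) := fun p q => by
    by_cases h : p = q
    · subst h; simp
    · simp [h]
  obtain ⟨h1, h2⟩ := natDegree_det_le_and_coeff (1 - S.map Polynomial.C * B) (fun q => m q.1)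
    (fun p q => by
      rw [hentry, hone]
      refine (Polynomial.natDegree_sub_le _ _).trans (max_le (by simp) ?_)
      exact Polynomial.natDegree_sum_le_of_forall_le _ _ fun r _ =>
        (Polynomial.natDegree_C_mul_le _ _).trans (hBdeg r q))
  rw [hsum] at h1 h2
  have hmat : (Matrix.of fun p q => ((1 - S.map Polynomial.C * B) p q).coeff (m q.1)) =
      -(S * B') := by
    ext p q
    rw [Matrix.of_apply, hentry, hone, Polynomial.coeff_sub,
      Polynomial.coeff_C_of_ne_zero (hm q.1).ne', Polynomial.finsetSum_coeff, zero_sub,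
      Matrix.neg_apply, Matrix.mul_apply]
    congr 1
    exact Finset.sum_congr rfl fun r _ => by rw [Polynomial.coeff_C_mul, hBcoeff]
  have hB'unit : B' * (edgeBlocks fun j =>
      !![0, Complex.exp (-A j); Complex.exp (-A j), 0]) = 1 := by
    rw [hB', edgeBlocks_mul, ← edgeBlocks_one]
    congr 1
    ext j e f
    fin_cases e <;> fin_cases f <;> simp [← Complex.exp_add]
  have hdet : (-(S * B')).det ≠ 0 := by
    have : -(S * B') * (-((edgeBlocks fun j =>
        !![0, Complex.exp (-A j); Complex.exp (-A j), 0]) * S)) = 1 := by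
      rw [neg_mul_neg, mul_assoc, ← mul_assoc B', hB'unit, one_mul, hS]
    have h3 := congrArg Matrix.det this
    rw [Matrix.det_mul, Matrix.det_one] at h3
    exact left_ne_zero_of_mul_eq_one h3
  refine le_antisymm h1 (Polynomial.le_natDegree_of_ne_zero ?_)
  rw [secularPolynomial, ← hB, h2, hmat]
  exact hdet

/-! ### The secular determinant of the graph and the conclusion. -/

lemma exists_uniform_bound {N : ℕ} {l : Fin N → ℝ} {a b : Fin N → ℝ → ℝ}
    (ha : BoundedContinuousOnEdges l a) (hb : BoundedContinuousOnEdges l b) :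
    ∃ C : ℝ, 0 ≤ C ∧ (∀ j, ∀ x ∈ Set.Ioo 0 (l j), |a j x| ≤ C) ∧
      ∀ j, ∀ x ∈ Set.Ioo 0 (l j), |b j x| ≤ C := by
  choose Ca hCa using fun j => (ha j).2
  choose Cb hCb using fun j => (hb j).2
  have hle : ∀ j, |Ca j| + |Cb j| ≤ ∑ j, (|Ca j| + |Cb j|) := fun j =>
    Finset.single_le_sum (f := fun j => |Ca j| + |Cb j|) (fun _ _ => by positivity)
      (Finset.mem_univ j)
  refine ⟨∑ j, (|Ca j| + |Cb j|), Finset.sum_nonneg fun _ _ => by positivity,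
    fun j x hx => ?_, fun j x hx => ?_⟩
  · linarith [hCa j x hx, hle j, le_abs_self (Ca j), abs_nonneg (Cb j)]
  · linarith [hCb j x hx, hle j, le_abs_self (Cb j), abs_nonneg (Ca j)]

/-- The constant terms depend only on the coupling and on the averages of the damping. -/
theorem exists_common_expansion {N : ℕ} {l₀ : ℝ} (hl₀ : 0 < l₀) {m : Fin N → ℕ}
    (hm : ∀ j, 0 < m j) {l : Fin N → ℝ} (hl : ∀ j, l j = m j * l₀)
    {U : Matrix (Fin N × Fin 2) (Fin N × Fin 2) ℂ}
    (hU : U ∈ Matrix.unitaryGroup (Fin N × Fin 2) ℂ) (A : Fin N → ℝ) :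
    ∃ c : Fin (2 * ∑ j, m j) → ℂ, ∀ a b : Fin N → ℝ → ℝ,
      BoundedContinuousOnEdges l a → BoundedContinuousOnEdges l b →
      (∀ j, ∫ t in (0 : ℝ)..(l j), a j t = A j) →
      HasHighFrequencyExpansion (graphEigenvalues l U a b) l₀ c := by
  obtain ⟨P, E, hP, hK⟩ := exists_coupling_normalization hU
  set S := 1 - 2 • P with hS
  have hSS : S * S = 1 := by
    rw [hS]
    simp only [two_smul, sub_mul, mul_sub, add_mul, mul_add, hP, one_mul, mul_one]
    abel
  -- The constants are obtained here, before a and b are introduced, from the coupling and the edge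
  -- integrals A alone.
  obtain ⟨c, κ, hκ, hc⟩ := exists_exp_factorization (secularPolynomial_natDegree hm A hSS)
    (by rw [secularPolynomial_eval_zero hm]; exact one_ne_zero) hl₀
  have hlpos : ∀ j, 0 < l j := fun j => by
    rw [hl j]
    have := hm j
    positivity
  refine ⟨c, fun a b ha hb hA => ?_⟩
  obtain ⟨C, hC0, haC, hbC⟩ := exists_uniform_bound ha hb
  choose o i hd hsol hex hlim using fun j =>
    exists_edge_scattering (hlpos j) hC0 (ha j).1 (hb j).1 (haC j) (hbC j)
  set Out : ℂ → Matrix (Fin N × Fin 2) (Fin N × Fin 2) ℂ := fun z =>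
    edgeBlocks fun j => o j z with hOut
  set In : ℂ → Matrix (Fin N × Fin 2) (Fin N × Fin 2) ℂ := fun z =>
    edgeBlocks fun j => i j z with hIn
  -- Inserting Ψ = Out x + In x and Ψ' = z(Out x - In x) into the coupling condition and multiplying
  -- by the invertible K for w = iz gives M(z)x = 0; the E terms are corrections of order 1/z.
  set M : ℂ → Matrix (Fin N × Fin 2) (Fin N × Fin 2) ℂ := fun z =>
    (1 + (Complex.I * z)⁻¹ • E) * Out z + (-S + (Complex.I * z)⁻¹ • E) * In z with hM
  have hIz : ∀ z : ℂ, z ≠ 0 → Complex.I * z ≠ 0 := fun z hz => mul_ne_zero Complex.I_ne_zero hz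
  have hcoup : ∀ z ≠ 0, ∀ (x : Fin N × Fin 2 → ℂ) (Ψ Ψ' : Fin N × Fin 2 → ℂ),
      (Out z).mulVec x + (In z).mulVec x = Ψ → z • ((Out z).mulVec x - (In z).mulVec x) = Ψ' →
      (CouplingCondition U Ψ Ψ' ↔ (M z).mulVec x = 0) := by
    intro z hz x Ψ Ψ' h1 h2
    obtain ⟨K, hKu, k1, k2⟩ := hK (Complex.I * z) (hIz z hz)
    have e : (M z).mulVec x = K.mulVec ((U - 1).mulVec Ψ + Complex.I • (U + 1).mulVec Ψ') := by
      have e1 : (U - 1).mulVec Ψ + Complex.I • (U + 1).mulVec Ψ' =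
          ((U - 1) + (Complex.I * z) • (U + 1)).mulVec ((Out z).mulVec x) +
          ((U - 1) - (Complex.I * z) • (U + 1)).mulVec ((In z).mulVec x) := by
        rw [← h1, ← h2]
        simp only [Matrix.mulVec_add, Matrix.mulVec_smul, Matrix.mulVec_sub, Matrix.sub_mulVec,
          Matrix.add_mulVec, Matrix.smul_mulVec, smul_add, smul_sub, smul_smul]
        abel
      have e2 : ∀ B O : Matrix (Fin N × Fin 2) (Fin N × Fin 2) ℂ,
          K.mulVec (B.mulVec (O.mulVec x)) = (K * B * O).mulVec x := fun B O => by
        simp only [Matrix.mulVec_mulVec, mul_assoc]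
      rw [e1, Matrix.mulVec_add, e2, e2, k1, k2, ← Matrix.add_mulVec]
    rw [e, CouplingCondition]
    constructor
    · intro h
      rw [h, Matrix.mulVec_zero]
    · intro h
      have hinj := Matrix.mulVec_injective_iff_isUnit.2 hKu
      exact hinj (by rw [h, Matrix.mulVec_zero])
  have hblock : ∀ z (x : Fin N × Fin 2 → ℂ) (u du : Fin N → ℝ → ℂ),
      (∀ j, (o j z).mulVec (fun f => x (j, f)) + (i j z).mulVec (fun f => x (j, f)) =
        ![u j 0, u j (l j)]) →
      (∀ j, z • ((o j z).mulVec (fun f => x (j, f)) - (i j z).mulVec (fun f => x (j, f))) =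
        ![du j 0, -du j (l j)]) →
      (Out z).mulVec x + (In z).mulVec x = endValues l u ∧
        z • ((Out z).mulVec x - (In z).mulVec x) = endDerivs l du := by
    intro z x u du h1 h2
    constructor
    · ext ⟨j, e⟩
      have := congrFun (h1 j) e
      rw [Pi.add_apply] at this
      rw [Pi.add_apply, edgeBlocks_mulVec, edgeBlocks_mulVec, this]
      fin_cases e <;> simp [endValues]
    · ext ⟨j, e⟩
      have := congrFun (h2 j) e
      rw [Pi.smul_apply, Pi.sub_apply] at this
      rw [Pi.smul_apply, Pi.sub_apply, edgeBlocks_mulVec, edgeBlocks_mulVec, this]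
      fin_cases e <;> simp [endDerivs]
  have hmem : ∀ z ≠ 0, (z ∈ graphEigenvalues l U a b ↔ (M z).det = 0) := by
    intro z hz
    rw [← Matrix.exists_mulVec_eq_zero_iff]
    constructor
    · rintro ⟨u, du, ddu, hsob, heq, hcc, j, y, hy, hne⟩
      choose x hx1 hx2 hx0 using fun j =>
        hsol j z hz (u j) (du j) ((hsob j).isEdgeSolution (hlpos j).le (heq j))
      obtain ⟨e1, e2⟩ := hblock z (fun p => x p.1 p.2) u du hx1 hx2
      refine ⟨fun p => x p.1 p.2, fun h0 => ?_, (hcoup z hz _ _ _ e1 e2).1 hcc⟩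
      exact hne (hx0 j (funext fun f => congrFun h0 (j, f)) y hy)
    · rintro ⟨x, hx, hMx⟩
      choose u du hs hx1 hx2 hx0 using fun j => hex j z hz (fun f => x (j, f))
      obtain ⟨e1, e2⟩ := hblock z x u du hx1 hx2
      refine ⟨u, du, fun j y => (z ^ 2 + 2 * z * a j y - b j y) * u j y, fun j =>
        (hs j).isSobolevW22 (continuousOn_coefficient (ha j).1 (hb j).1 z)
          (fun y hy => norm_coefficient_le z (haC j y hy) (hbC j y hy)),
        fun j => Eventually.of_forall fun y => sub_self _, (hcoup z hz _ _ _ e1 e2).2 hMx, ?_⟩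
      by_contra! hcon
      refine hx (funext fun p => ?_)
      exact congrFun (hx0 p.1 (hcon p.1)) p.2
  have hMd : ∀ z ≠ 0, DifferentiableAt ℂ (fun z => (M z).det) z := by
    intro z hz
    have hOd : ∀ p q, DifferentiableAt ℂ (fun z => Out z p q) z := fun p q => by
      simp only [hOut, edgeBlocks, Matrix.of_apply]
      split_ifs
      · exact (hd p.1 p.2 q.2 z hz).1
      · exact differentiableAt_const _
    have hId : ∀ p q, DifferentiableAt ℂ (fun z => In z p q) z := fun p q => by
      simp only [hIn, edgeBlocks, Matrix.of_apply]
      split_ifs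
      · exact (hd p.1 p.2 q.2 z hz).2
      · exact differentiableAt_const _
    have hinv : DifferentiableAt ℂ (fun z : ℂ => (Complex.I * z)⁻¹) z := by
      have := hIz z hz
      fun_prop (disch := assumption)
    have hent : ∀ p q, DifferentiableAt ℂ (fun z => M z p q) z := fun p q => by
      simp only [hM, Matrix.add_apply, Matrix.mul_apply, Matrix.smul_apply, smul_eq_mul]
      fun_prop
    simp only [Matrix.det_apply']
    fun_prop
  refine hasHighFrequencyExpansion_of_secular hl₀ c hκ (D := fun z => (M z).det) hMd
    -- Any positive bound on |Im z| would do; it only excludes z = 0.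
    ⟨1, fun z hz => hmem z (by rintro rfl; norm_num at hz)⟩
    ⟨C, fun z hz him => abs_re_le_of_mem_graphEigenvalues hlpos hU (fun j => (ha j).1)
      (fun j => (hb j).1) haC hbC hz him⟩ fun R => ?_
  set W : ℂ → Matrix (Fin N × Fin 2) (Fin N × Fin 2) ℂ := fun z => edgeBlocks fun j =>
    !![0, Complex.exp (z * l j + A j); Complex.exp (z * l j + A j), 0] with hW
  have hWO : ∀ p q, (fun z => W z p q) =O[highFrequencyFilter R] (fun _ => (1 : ℝ)) := by
    have h0 : (fun _ : ℂ => (0 : ℂ)) =O[highFrequencyFilter R] (fun _ => (1 : ℝ)) :=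
      isBigO_const_const _ one_ne_zero _
    rintro ⟨j, e⟩ ⟨k, f⟩
    by_cases h : j = k
    · subst h
      have h1 := isBigO_exp_highFrequencyFilter R (l j) (A j)
      fin_cases e <;> fin_cases f
      · exact h0.congr_left fun z => by simp [hW, edgeBlocks]
      · exact h1.congr_left fun z => by simp [hW, edgeBlocks]
      · exact h1.congr_left fun z => by simp [hW, edgeBlocks]
      · exact h0.congr_left fun z => by simp [hW, edgeBlocks]
    · exact h0.congr_left fun z => by simp [hW, edgeBlocks, h]
  have hlimO : Tendsto Out (highFrequencyFilter R) (𝓝 1) := by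
    refine tendsto_pi_nhds.2 fun p => tendsto_pi_nhds.2 fun q => ?_
    rw [← edgeBlocks_one]
    simp only [hOut, edgeBlocks, Matrix.of_apply]
    split_ifs
    · exact (hlim p.1 R p.2 q.2).1
    · exact tendsto_const_nhds
  have hlimI : Tendsto (fun z => In z - W z) (highFrequencyFilter R) (𝓝 0) := by
    refine tendsto_pi_nhds.2 fun p => tendsto_pi_nhds.2 fun q => ?_
    simp only [hIn, hW, edgeBlocks, Matrix.sub_apply, Matrix.of_apply, Matrix.zero_apply]
    split_ifs
    · have := (hlim p.1 R p.2 q.2).2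
      rwa [hA p.1] at this
    · simpa using tendsto_const_nhds
  have hinv : Tendsto (fun z : ℂ => (Complex.I * z)⁻¹) (highFrequencyFilter R) (𝓝 0) := by
    have := (tendsto_inv_highFrequencyFilter R).const_mul (Complex.I)⁻¹
    rw [mul_zero] at this
    exact this.congr fun z => (mul_inv _ _).symm
  have hlimW : Tendsto (fun z => (Complex.I * z)⁻¹ • W z) (highFrequencyFilter R) (𝓝 0) :=
    tendsto_pi_nhds.2 fun p => tendsto_pi_nhds.2 fun q =>
      tendsto_zero_of_isBigO_mul (hWO p q) hinv (Eventually.of_forall fun z => mul_comm _ _)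
  have hMlim : Tendsto (fun z => M z - (1 - S * W z)) (highFrequencyFilter R) (𝓝 0) := by
    have t1 := hlimO.sub_const 1
    have t2 := (hinv.smul hlimO).const_mul E
    have t3 := hlimI.const_mul (-S)
    have t4 := (hinv.smul hlimI).const_mul E
    have t5 := hlimW.const_mul E
    have t := (((t1.add t2).add t3).add t4).add t5
    simp only [sub_self, zero_smul, mul_zero, add_zero] at t
    refine t.congr fun z => ?_
    simp only [hM, add_mul, smul_mul_assoc, mul_smul_comm, one_mul, neg_mul, mul_sub, smul_sub]
    abel
  have hS1 : ∀ p q, (fun z => (1 - S * W z) p q) =O[highFrequencyFilter R] (fun _ => (1 : ℝ)) := by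
    intro p q
    simp only [Matrix.sub_apply, Matrix.mul_apply]
    refine (isBigO_const_const _ one_ne_zero _).sub (IsBigO.fun_sum fun r _ => ?_)
    exact (hWO r q).const_mul_left _
  refine (tendsto_det_sub_det hMlim hS1).congr fun z => ?_
  -- Commensurability enters here: every edge factor is a constant times a power of the single
  -- variable w = e^{l₀z}.
  have hexp : ∀ j, Complex.exp (z * l j + A j) =
      Complex.exp (A j) * Complex.exp (l₀ * z) ^ m j := fun j => by
    rw [← Complex.exp_nat_mul, ← Complex.exp_add, hl j]
    congr 1
    push_cast
    ring
  rw [← hc, secularPolynomial_eval]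
  simp only [hW, hexp]

end

theorem mainTheorem2 {N : ℕ} (l₀ : ℝ) (hl₀ : 0 < l₀) (m : Fin N → ℕ) (hm : ∀ j, 0 < m j)
    (l : Fin N → ℝ) (hl : ∀ j, l j = m j * l₀)
    (U : Matrix (Fin N × Fin 2) (Fin N × Fin 2) ℂ)
    (hU : U ∈ Matrix.unitaryGroup (Fin N × Fin 2) ℂ)
    (a b : Fin N → ℝ → ℝ)
    (ha : BoundedContinuousOnEdges l a) (hb : BoundedContinuousOnEdges l b) :
    -- both problems have asymptotics `2πin/l₀ + c_s + o(1)`, with the same constant terms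
    (∃ c : Fin (2 * ∑ j, m j) → ℂ,
      HasHighFrequencyExpansion (graphEigenvalues l U a b) l₀ c ∧
      HasHighFrequencyExpansion (graphEigenvalues l U (averaged l a) (averaged l b)) l₀ c) ∧
    (constantTerms (graphEigenvalues l U a b) l₀ atTop =
      constantTerms (graphEigenvalues l U (averaged l a) (averaged l b)) l₀ atTop) ∧
    (constantTerms (graphEigenvalues l U a b) l₀ atBot =
      constantTerms (graphEigenvalues l U (averaged l a) (averaged l b)) l₀ atBot) ∧
    (highFrequencyAbscissas (graphEigenvalues l U a b) =
      highFrequencyAbscissas (graphEigenvalues l U (averaged l a) (averaged l b))) ∧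
    -- the high frequency abscissas depend only on the averages of the damping
    (∀ a' b' : Fin N → ℝ → ℝ,
      BoundedContinuousOnEdges l a' → BoundedContinuousOnEdges l b' →
      (∀ j, edgeAverage (l j) (a' j) = edgeAverage (l j) (a j)) →
      highFrequencyAbscissas (graphEigenvalues l U a' b') =
        highFrequencyAbscissas (graphEigenvalues l U a b)) := by
  have hlpos : ∀ j, 0 < l j := fun j => by
    rw [hl j]
    have := hm j
    positivity
  have hav : ∀ f : Fin N → ℝ → ℝ, BoundedContinuousOnEdges l (averaged l f) := fun f j =>
    ⟨continuousOn_const, |edgeAverage (l j) (f j)|, fun _ _ => le_rfl⟩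
  have hintegral : ∀ (f : ℝ → ℝ) j, ∫ t in (0 : ℝ)..(l j), f t = l j * edgeAverage (l j) f :=
    fun f j => (mul_inv_cancel_left₀ (hlpos j).ne' _).symm
  -- Averaging preserves the edge integrals of the damping, as does any a' with the same averages,
  -- so one family c serves all the problems, whatever the potentials.
  obtain ⟨c, hc⟩ := exists_common_expansion hl₀ hm hl hU
    fun j => ∫ t in (0 : ℝ)..(l j), a j t
  have h1 := hc a b ha hb fun _ => rfl
  have h2 := hc (averaged l a) (averaged l b) (hav a) (hav b) fun j => by
    rw [hintegral (a j)]
    simp [averaged]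
  obtain ⟨e1, e2⟩ := constantTerms_eq hl₀ h1 h2
  refine ⟨⟨c, h1, h2⟩, e1, e2, ?_, fun a' b' ha' hb' hab => ?_⟩
  · rw [highFrequencyAbscissas_eq_range hl₀ h1, highFrequencyAbscissas_eq_range hl₀ h2]
  · have h3 := hc a' b' ha' hb' fun j => by rw [hintegral, hintegral, hab]
    rw [highFrequencyAbscissas_eq_range hl₀ h1, highFrequencyAbscissas_eq_range hl₀ h3]
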